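/- Setting. A signature $\mathcal R$ consists of finitely many relation symbols with positive arities; a fact is an expression $R(c_1,\dots,c_k)$, where $R\in\mathcal R$ has arity $k$ and the $c_i$ are constants from a fixed set. An inconsistent prioritizing instance $D=(I,\mathcal H,\succ)$ over $\mathcal R$ consists of a finite set $I$ of facts, a hypergraph $\mathcal H$ with node set $I$ (the conflict hypergraph, which is arbitrary), and an acyclic binary relation $\succ$ on $I$ such that $f\succ g$ implies that $f$ and $g$ are neighbors, i.e., distinct and contained in a common hyperedge of $\mathcal H$. The relation $\succ$ is transitive if, for all neighbors $f,g$ such that $(f,g)$ is in the transitive closure of $\succ$, we have $f\succ g$. A set $J\subseteq I$ is consistent if it contains no hyperedge of $\mathcal H$. For distinct consistent $J,J'$, the set $J$ is a global improvement of $J'$ if for every $f'\in J'\setminus J$ there is $f\in J\setminus J'$ with $f\succ f'$. A consistent $J$ is a g-repair of $D$ if it has no global improvement, and a c-repair of $D$ if it is a g-repair of some completion $(I,\mathcal H,\succ_c)$ of $D$, that is, of some inconsistent prioritizing instance such that $\succ_c$ contains $\succ$ and any two neighbors are comparable by $\succ_c$. The problem g-categoricity (respectively, c-categoricity) is to decide,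 given $\mathcal R$ and $D$, whether $D$ has exactly one g-repair (respectively, exactly one c-repair). Statement. (1) For transitive priority relations the two problems coincide: for every signature $\mathcal R$ and every inconsistent prioritizing instance $D=(I,\mathcal H,\succ)$ over $\mathcal R$ with $\succ$ transitive, $D$ has exactly one g-repair if and only if $D$ has exactly one c-repair. (2) Consequently, g-categoricity restricted to instances with a transitive priority relation is solvable in polynomial time: there are a multi-stack Turing machine and a polynomial $p$ such that, for every signature $\mathcal R$ and every inconsistent prioritizing instance $D$ over $\mathcal R$ with an arbitrary conflict hypergraph and a transitive priority relation, given as a word $w$ that lists the arities, the facts, the hyperedges and the pairs of $\succ$ explicitly (numbers in binary, constants as bit strings), the machine halts within $p(|w|)$ steps with the correct answer to whether $D$ has exactly one g-repair. -/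

import Mathlib

namespace PrefRepair

universe u

/-! ### Prioritizing instances and preferred repairs -/

/-- A relational signature: finitely many relation symbols, each with a positive arity. -/
structure Signature where
  numRel : ℕ
  arity : Fin numRel → ℕ
  arity_pos : ∀ R, 0 < arity R

/-- A fact `R(t)` over the signature `S`, with values in the set `C` of constants. -/
abbrev Fact (S : Signature) (C : Type u) : Type u :=
  (R : Fin S.numRel) × (Fin (S.arity R) → C)

/-- An inconsistent prioritizing instance `(I, H, ≻)` over `S`: a finite set `I` of facts, a
hypergraph `H` on the node set `I`, and an acyclic relation `≻` on `I` that relates only facts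
co-occurring in some hyperedge of `H`. -/
structure PrioritizingInstance (S : Signature) (C : Type u) where
  facts : Finset (Fact S C)
  edges : Finset (Finset (Fact S C))
  edges_subset : ∀ e ∈ edges, e ⊆ facts
  Prefers : Fact S C → Fact S C → Prop
  prefers_mem : ∀ f g, Prefers f g → f ∈ facts ∧ g ∈ facts
  acyclic : ∀ f, ¬ Relation.TransGen Prefers f f
  prefers_edge : ∀ f g, Prefers f g → ∃ e ∈ edges, f ∈ e ∧ g ∈ e

namespace PrioritizingInstance

variable {S : Signature} {C : Type u}

/-- Two (different) facts are neighbors if they co-occur in some hyperedge. -/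
def Neighbors (D : PrioritizingInstance S C) (f g : Fact S C) : Prop :=
  f ≠ g ∧ ∃ e ∈ D.edges, f ∈ e ∧ g ∈ e

/-- `J` is a consistent subinstance: a subset of `I` that is independent in `H`. -/
def Consistent (D : PrioritizingInstance S C) (J : Finset (Fact S C)) : Prop :=
  J ⊆ D.facts ∧ ∀ e ∈ D.edges, ¬ e ⊆ J

/-- The priority relation is total: any two neighbors are comparable. -/
def Total (D : PrioritizingInstance S C) : Prop :=
  ∀ f g, D.Neighbors f g → D.Prefers f g ∨ D.Prefers g f

/-- The priority relation is transitive: it contains its transitive closure restricted to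
neighbors. -/
def Transitive (D : PrioritizingInstance S C) : Prop :=
  ∀ f g, D.Neighbors f g → Relation.TransGen D.Prefers f g → D.Prefers f g

/-- `Dc` is a completion of `D`: the same facts and hypergraph, and a total priority relation
that extends the one of `D`. -/
def IsCompletion (D Dc : PrioritizingInstance S C) : Prop :=
  Dc.facts = D.facts ∧ Dc.edges = D.edges ∧
    (∀ f g, D.Prefers f g → Dc.Prefers f g) ∧ Dc.Total

/-- `J` is a global improvement of `J'`. -/
def GlobalImprovement (D : PrioritizingInstance S C) (J J' : Finset (Fact S C)) : Prop :=
  D.Consistent J ∧ D.Consistent J' ∧ J ≠ J' ∧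
    ∀ f' ∈ J', f' ∉ J → ∃ f ∈ J, f ∉ J' ∧ D.Prefers f f'

/-- The globally-optimal repairs: consistent subinstances without a global improvement. -/
def gRepairs (D : PrioritizingInstance S C) : Set (Finset (Fact S C)) :=
  {J | D.Consistent J ∧ ¬ ∃ K, D.GlobalImprovement K J}

/-- The completion-optimal repairs: those that are globally optimal for some completion. -/
def cRepairs (D : PrioritizingInstance S C) : Set (Finset (Fact S C)) :=
  {J | D.Consistent J ∧ ∃ Dc, D.IsCompletion Dc ∧ J ∈ Dc.gRepairs}

/-- There is precisely one globally-optimal repair. -/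
def GCategorical (D : PrioritizingInstance S C) : Prop := D.gRepairs.ncard = 1

/-- There is precisely one completion-optimal repair. -/
def CCategorical (D : PrioritizingInstance S C) : Prop := D.cRepairs.ncard = 1

end PrioritizingInstance

/-! ### Prioritizing instances as inputs of a machine

Constants are bit strings. An input lists the arities of the signature, the facts of `I`, the
hyperedges of `H` (each as a list of facts) and the pairs `(f, g)` with `f ≻ g`, in any order. -/

/-- The raw data of an input. -/
structure Description where
  sig : Signature
  facts : List (Fact sig (List Bool))
  edges : List (List (Fact sig (List Bool)))
  prio : List (Fact sig (List Bool) × Fact sig (List Bool))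

/-- The lists in `d` enumerate the facts, the hyperedges and the priority relation of `D`. -/
def Description.Describes (d : Description) (D : PrioritizingInstance d.sig (List Bool)) : Prop :=
  (∀ f, f ∈ d.facts ↔ f ∈ D.facts) ∧
  (∀ e : Finset (Fact d.sig (List Bool)),
    e ∈ D.edges ↔ ∃ l ∈ d.edges, ∀ f, f ∈ l ↔ f ∈ e) ∧
  (∀ f g, (f, g) ∈ d.prio ↔ D.Prefers f g)

/-- The input alphabet. -/
inductive Sym
  | bit (b : Bool)
  | endString
  | endFact
  | endGroup
  | endSection

def encodeString (s : List Bool) : List Sym := s.map Sym.bit ++ [Sym.endString]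

/-- The index of the relation symbol in binary, followed by the constants. -/
def encodeFact {S : Signature} (f : Fact S (List Bool)) : List Sym :=
  (Computability.encodeNat f.1 :: List.ofFn f.2).flatMap encodeString ++ [Sym.endFact]

def encodeGroup {S : Signature} (l : List (Fact S (List Bool))) : List Sym :=
  l.flatMap encodeFact ++ [Sym.endGroup]

/-- The whole input as a word: arities in binary, facts, hyperedges, priority pairs. -/
def Description.encode (d : Description) : List Sym :=
  ((List.ofFn d.sig.arity).map Computability.encodeNat).flatMap encodeString ++
    Sym.endSection :: (d.facts.flatMap encodeFact ++
    Sym.endSection :: (d.edges.flatMap encodeGroup ++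
    Sym.endSection :: ((d.prio.map fun p => [p.1, p.2]).flatMap encodeGroup ++
    [Sym.endSection])))

/-- The inputs of g-categoricity for transitive priority relations: a prioritizing instance whose
priority relation is transitive, together with a description of it. -/
structure TransitiveInput where
  desc : Description
  inst : PrioritizingInstance desc.sig (List Bool)
  describes : desc.Describes inst
  transitive : inst.Transitive

/-- The word that the machine receives. -/
def TransitiveInput.encode (x : TransitiveInput) : List Sym := x.desc.encode

open Classical in
/-- The answer to g-categoricity. -/
noncomputable def TransitiveInput.gCategorical (x : TransitiveInput) : Bool :=
  decide x.inst.GCategorical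

/-! ### Every instance has a description, and the encoding is unambiguous -/

theorem exists_describes {S : Signature} (D : PrioritizingInstance S (List Bool)) :
    ∃ (fs : List (Fact S (List Bool))) (es : List (List (Fact S (List Bool))))
      (ps : List (Fact S (List Bool) × Fact S (List Bool))),
      (Description.mk S fs es ps).Describes D := by
  classical
  refine ⟨D.facts.toList, D.edges.toList.map Finset.toList,
    ((D.facts ×ˢ D.facts).filter fun p => D.Prefers p.1 p.2).toList, ?_, ?_, ?_⟩
  · simp
  · intro e
    constructor
    · intro he
      exact ⟨e.toList, by simpa using ⟨e, he, rfl⟩, by simp⟩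
    · rintro ⟨l, hl, hle⟩
      simp only [List.mem_map, Finset.mem_toList] at hl
      obtain ⟨e', he', rfl⟩ := hl
      have : e' = e := by ext f; simpa using hle f
      exact this ▸ he'
  · intro f g
    simp only [Finset.mem_toList, Finset.mem_filter, Finset.mem_product]
    exact ⟨fun h => h.2, fun h => ⟨D.prefers_mem f g h, h⟩⟩

theorem split_at_terminator {α : Type*} {t : α} {a b r s : List α} (ha : t ∉ a) (hb : t ∉ b)
    (h : a ++ t :: r = b ++ t :: s) : a = b ∧ r = s := by
  induction a generalizing b with
  | nil => cases b with
    | nil => simpa using h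
    | cons y b => simp at h hb; exact absurd h.1 hb.1
  | cons x a ih => cases b with
    | nil => simp at h ha; exact absurd h.1.symm ha.1
    | cons y b =>
      simp at h ha hb
      obtain ⟨h1, h2⟩ := ih ha.2 hb.2 h.2
      exact ⟨by rw [h.1, h1], h2⟩

theorem flatMap_injective {α β : Type*} (t : β) (enc body : α → List β)
    (henc : ∀ x, enc x = body x ++ [t]) (ht : ∀ x, t ∉ body x)
    (hinj : Function.Injective body) :
    Function.Injective fun l : List α => l.flatMap enc := by
  intro l l' h
  induction l generalizing l' with
  | nil => cases l' with
    | nil => rfl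
    | cons y l' => simp [henc] at h
  | cons x l ih => cases l' with
    | nil => simp [henc] at h
    | cons y l' =>
      simp only [List.flatMap_cons, henc, List.append_assoc, List.singleton_append] at h
      obtain ⟨h1, h2⟩ := split_at_terminator (ht x) (ht y) h
      rw [hinj h1, ih (l' := l') (by simpa only [henc] using h2)]

theorem flatMap_encodeString_injective :
    Function.Injective fun l : List (List Bool) => l.flatMap encodeString :=
  flatMap_injective Sym.endString _ (fun s => s.map Sym.bit) (fun _ => rfl) (by simp)
    (List.map_injective_iff.2 fun a b h => by cases h; rfl)

theorem flatMap_encodeFact_injective {S : Signature} :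
    Function.Injective fun l : List (Fact S (List Bool)) => l.flatMap encodeFact := by
  refine flatMap_injective Sym.endFact _
    (fun f => (Computability.encodeNat f.1 :: List.ofFn f.2).flatMap encodeString)
    (fun _ => rfl) (by simp [encodeString]) ?_
  rintro ⟨R, s⟩ ⟨R', s'⟩ h
  have h' := flatMap_encodeString_injective h
  simp only [List.cons.injEq] at h'
  have hR : R = R' := Fin.ext (Computability.encodingNatBool.encode_injective h'.1)
  subst hR
  rw [List.ofFn_injective h'.2]

theorem flatMap_encodeGroup_injective {S : Signature} :
    Function.Injective fun l : List (List (Fact S (List Bool))) => l.flatMap encodeGroup :=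
  flatMap_injective Sym.endGroup _ (fun l => l.flatMap encodeFact) (fun _ => rfl)
    (by simp [encodeFact, encodeString]) flatMap_encodeFact_injective

theorem Description.encode_injective : Function.Injective Description.encode := by
  rintro ⟨⟨n, a, ha⟩, fs, es, ps⟩ ⟨⟨n', a', ha'⟩, fs', es', ps'⟩ h
  have hs (l : List (List Bool)) : Sym.endSection ∉ l.flatMap encodeString := by
    simp [encodeString]
  have hf {S : Signature} (l : List (Fact S (List Bool))) :
      Sym.endSection ∉ l.flatMap encodeFact := by simp [encodeFact, encodeString]
  have hg {S : Signature} (l : List (List (Fact S (List Bool)))) :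
      Sym.endSection ∉ l.flatMap encodeGroup := by simp [encodeGroup, encodeFact, encodeString]
  simp only [Description.encode] at h
  obtain ⟨h1, h⟩ := split_at_terminator (hs _) (hs _) h
  have h1 := List.map_injective_iff.2 Computability.encodingNatBool.encode_injective
    (flatMap_encodeString_injective h1)
  obtain ⟨rfl, h1⟩ := Sigma.mk.inj (List.ofFn_inj'.1 h1)
  obtain rfl := eq_of_heq h1
  obtain ⟨h2, h⟩ := split_at_terminator (hf _) (hf _) h
  obtain ⟨h3, h⟩ := split_at_terminator (hg _) (hg _) h
  obtain ⟨h4, -⟩ := split_at_terminator (hg _) (hg _) h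
  have h2 := flatMap_encodeFact_injective h2
  have h3 := flatMap_encodeGroup_injective h3
  have hp {α : Type} : Function.Injective fun p : α × α => [p.1, p.2] :=
    fun p q h => by simpa [Prod.ext_iff] using h
  have h4 : ps = ps' := List.map_injective_iff.2 hp (flatMap_encodeGroup_injective h4)
  subst h2 h3 h4
  rfl

/-- Different inputs are given to the machine as different words. -/
theorem TransitiveInput.encode_injective : Function.Injective TransitiveInput.encode := by
  rintro ⟨d, D, h, hD⟩ ⟨d', D', h', hD'⟩ he
  obtain rfl : d = d' := Description.encode_injective he
  obtain ⟨F, E, _, P, _, _, _⟩ := D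
  obtain ⟨F', E', _, P', _, _, _⟩ := D'
  obtain rfl : F = F' := by ext f; exact (h.1 f).symm.trans (h'.1 f)
  obtain rfl : E = E' := by ext e; exact (h.2.1 e).trans (h'.2.1 e).symm
  obtain rfl : P = P' := by
    ext f g; exact (h.2.2 f g).symm.trans (h'.2.2 f g)
  rfl

end PrefRepair

/-! Call a consistent set `G` decisive if every fact `f` outside `G` lies in a hyperedge whose other
facts all belong to `G` and are preferred to `f`. Such a `G` improves every other consistent set,
since a consistent `J` containing `f` must miss one of those preferred facts. A descent along the
priority relation shows that nothing improves `G`. So a decisive set is the only g-repair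
(`Decisive.gRepairs_eq`).

If the relation is total and no hyperedge is empty, the greedy procedure, which drops `f` exactly
when some hyperedge through `f` has all its other facts kept and preferred to `f`, yields a decisive
set (`Total.exists_decisive`). Hence every completion has exactly one g-repair. Since c-repairs are
g-repairs, exactly one g-repair implies exactly one c-repair.

Conversely, let `G` be the only c-repair and `f` a fact outside `G`. Take a completion in which only
facts above `f` in the transitive closure are preferred to `f` (`exists_completion`). Its decisive
set must be `G`, which gives a hyperedge through `f` whose other facts lie in `G` and above `f`.
They are neighbors of `f`, so transitivity makes them preferred to `f` already in `D`. Thus `G` is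
decisive for `D` (`Transitive.exists_decisive`), and for transitive relations both notions amount to
the existence of a decisive set.

This existence is decidable in polynomial time. Any decisive set agrees with the solution of the
greedy recursion (`Decisive.mem_iff`), so it suffices to compute that solution and to test whether
it contains a hyperedge. The machine starts with no fact kept and repeatedly re-evaluates the greedy
rule for all facts in place. After `n` passes all facts with fewer than `n` facts above them are
right (`finallyKept_eq`), so as many passes as facts suffice. The algorithm is written in a small
language of while programs on stacks, compiled to multi-stack Turing machines by `polyTime_of_runs`.
Facts carry two mark bits, and the main subroutine `sweep` compares all facts of a list with a given
one, updating marks and flags. -/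

namespace PrefRepair

universe u

/-! ### Decisive sets and the equivalence of the two categoricity notions. -/

namespace PrioritizingInstance

variable {S : Signature} {C : Type u} (D : PrioritizingInstance S C)

open Classical in
/-- The number of facts that are above `f` in the transitive closure of the priority relation. -/
noncomputable def height (f : Fact S C) : ℕ :=
  (D.facts.filter fun g => Relation.TransGen D.Prefers g f).card

variable {D}

theorem mem_facts_of_transGen {f g : Fact S C} (h : Relation.TransGen D.Prefers f g) :
    f ∈ D.facts := by
  induction h using Relation.TransGen.head_induction_on with
  | single h => exact (D.prefers_mem _ _ h).1
  | head h _ _ => exact (D.prefers_mem _ _ h).1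

/-- Whatever is above `f` is above `g`, and `f` itself is above `g` but, by acyclicity, not above
`f`. This rank serves for descent arguments and bounds the number of passes of the machine. -/
theorem height_lt_of_transGen {f g : Fact S C} (h : Relation.TransGen D.Prefers f g) :
    D.height f < D.height g := by
  classical
  refine Finset.card_lt_card (Finset.ssubset_iff_of_subset ?_ |>.2 ⟨f, ?_, ?_⟩)
  · intro x hx
    simp only [Finset.mem_filter] at hx ⊢
    exact ⟨hx.1, hx.2.trans h⟩
  · simpa using ⟨mem_facts_of_transGen h, h⟩
  · simpa using fun _ => D.acyclic f

theorem height_lt {f g : Fact S C} (h : D.Prefers f g) : D.height f < D.height g :=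
  height_lt_of_transGen (.single h)

theorem height_lt_card {f : Fact S C} (hf : f ∈ D.facts) : D.height f < D.facts.card := by
  classical
  refine Finset.card_lt_card (Finset.ssubset_iff_of_subset (Finset.filter_subset _ _) |>.2
    ⟨f, hf, ?_⟩)
  simpa using fun _ => D.acyclic f

variable (D) in
/-- A consistent set `G` such that every fact outside of `G` is the least fact of some hyperedge
whose other facts belong to `G`. -/
def Decisive (G : Finset (Fact S C)) : Prop :=
  D.Consistent G ∧ ∀ f ∈ D.facts, f ∉ G →
    ∃ e ∈ D.edges, f ∈ e ∧ ∀ g ∈ e, g ≠ f → g ∈ G ∧ D.Prefers g f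

/-- The hyperedge that excludes `f` is not contained in `J`. The fact of it that `J` misses is not
`f`, so it lies in `G` and is preferred to `f`. -/
theorem Decisive.exists_prefers {G J : Finset (Fact S C)} (hG : D.Decisive G)
    (hJ : D.Consistent J) {f : Fact S C} (hf : f ∈ J) (hfG : f ∉ G) :
    ∃ g ∈ G, g ∉ J ∧ D.Prefers g f := by
  obtain ⟨e, he, hfe, h⟩ := hG.2 f (hJ.1 hf) hfG
  obtain ⟨g, hge, hgJ⟩ := Finset.not_subset.1 (hJ.2 e he)
  have := h g hge (by rintro rfl; exact hgJ hf)
  exact ⟨g, this.1, hgJ, this.2⟩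

theorem Decisive.gRepairs_eq {G : Finset (Fact S C)} (hG : D.Decisive G) : D.gRepairs = {G} := by
  ext J
  simp only [Set.mem_singleton_iff]
  constructor
  · rintro ⟨hJ, hno⟩
    by_contra hne
    exact hno ⟨G, hG.1, hJ, fun h => hne h.symm, fun f hf hfG => hG.exists_prefers hJ hf hfG⟩
  · rintro rfl
    refine ⟨hG.1, ?_⟩
    rintro ⟨K, hK, -, hne, himp⟩
    classical
    by_cases hsub : (K \ J).Nonempty
    -- `J` is now the decisive set. A newly gained fact of least height is beaten by some lost fact,
    -- which the improvement must compensate by a gained fact of still smaller height.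
    · obtain ⟨f, hf, hmin⟩ := Finset.exists_min_image (K \ J) D.height hsub
      simp only [Finset.mem_sdiff] at hf hmin
      obtain ⟨g, hg, hgK, hgf⟩ := hG.exists_prefers hK hf.1 hf.2
      obtain ⟨f', hf', hfJ', hfg⟩ := himp g hg hgK
      have h1 := hmin f' ⟨hf', hfJ'⟩
      have h2 := height_lt hgf
      have h3 := height_lt hfg
      omega
    · have hKJ : K ⊆ J := by
        simpa [Finset.not_nonempty_iff_eq_empty, Finset.sdiff_eq_empty_iff_subset] using hsub
      refine hne (hKJ.antisymm fun f hf => ?_)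
      by_contra hfK
      obtain ⟨f', hf', hfJ', -⟩ := himp f hf hfK
      exact hfJ' (hKJ hf')

/-- The greedy recursion along a priority relation has a solution. -/
theorem exists_greedy (D : PrioritizingInstance S C) :
    ∃ G : Fact S C → Prop, ∀ f, G f ↔
      ¬ ∃ e ∈ D.edges, f ∈ e ∧ ∀ g ∈ e, g ≠ f → G g ∧ D.Prefers g f := by
  have wf : WellFounded D.Prefers :=
    Subrelation.wf (fun h => height_lt h) (measure D.height).wf
  -- Well-founded recursion may consult `G` only at facts preferred to `f`, so the preference is
  -- bundled with the recursive call.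
  refine ⟨wf.fix fun f G => ¬ ∃ e ∈ D.edges, f ∈ e ∧ ∀ g ∈ e, g ≠ f →
    ∃ h : D.Prefers g f, G g h, fun f => ?_⟩
  rw [wf.fix_eq]
  simp only [exists_prop, and_comm]

/-- The facts kept greedily are consistent: in a wholly kept hyperedge, totality makes all other
facts preferred to the one of greatest height, which would therefore have been dropped. Decisiveness
is the greedy rule itself. -/
theorem Total.exists_decisive (ht : D.Total) (hne : ∅ ∉ D.edges) : ∃ G, D.Decisive G := by
  classical
  obtain ⟨G, hG⟩ := D.exists_greedy
  refine ⟨D.facts.filter G, ⟨Finset.filter_subset _ _, fun e he hsub => ?_⟩, fun f hf hfG => ?_⟩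
  · obtain ⟨f, hf, hmax⟩ := Finset.exists_max_image e D.height
      (Finset.nonempty_iff_ne_empty.2 fun h => hne (h ▸ he))
    have hfG := (Finset.mem_filter.1 (hsub hf)).2
    refine (hG f).1 hfG ⟨e, he, hf, fun g hg hgf => ⟨(Finset.mem_filter.1 (hsub hg)).2, ?_⟩⟩
    refine (ht g f ⟨hgf, e, he, hg, hf⟩).resolve_right fun h => ?_
    have := hmax g hg
    have := height_lt h
    omega
  · have : ¬ G f := fun h => hfG (Finset.mem_filter.2 ⟨hf, h⟩)
    rw [hG, not_not] at this
    obtain ⟨e, he, hfe, h⟩ := this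
    exact ⟨e, he, hfe, fun g hg hgf =>
      ⟨Finset.mem_filter.2 ⟨D.edges_subset e he hg, (h g hg hgf).1⟩, (h g hg hgf).2⟩⟩

theorem Consistent.empty_notMem {J : Finset (Fact S C)} (h : D.Consistent J) : ∅ ∉ D.edges :=
  fun he => h.2 ∅ he (Finset.empty_subset _)

/-- There is a completion in which only the facts above `f` are preferred to `f`. -/
theorem exists_completion (D : PrioritizingInstance S C) (f : Fact S C) :
    ∃ Dc, D.IsCompletion Dc ∧ ∀ g, Dc.Prefers g f → Relation.TransGen D.Prefers g f := by
  let U : Fact S C → Prop := fun g => Relation.ReflTransGen D.Prefers g f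
  have hU : ∀ {a b}, Relation.TransGen D.Prefers a b → U b → U a := fun h h' =>
    h.to_reflTransGen.trans h'
  -- All facts weakly above `f` are placed before all others. The facts weakly above `f` are closed
  -- upwards, so this is compatible with the priority relation.
  let r : Fact S C → Fact S C → Prop := fun a b =>
    a = b ∨ Relation.TransGen D.Prefers a b ∨ (U a ∧ ¬ U b)
  have : IsPartialOrder (Fact S C) r :=
    { refl := fun a => Or.inl rfl
      trans := by
        rintro a b c (rfl | h | h) (rfl | h' | h')
        · exact Or.inl rfl
        · exact Or.inr (Or.inl h')
        · exact Or.inr (Or.inr h')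
        · exact Or.inr (Or.inl h)
        · exact Or.inr (Or.inl (h.trans h'))
        · exact Or.inr (Or.inr ⟨hU h h'.1, h'.2⟩)
        · exact Or.inr (Or.inr h)
        · exact Or.inr (Or.inr ⟨h.1, fun hc => h.2 (hU h' hc)⟩)
        · exact absurd h'.1 h.2
      antisymm := by
        rintro a b (h | h | h) (h' | h' | h')
        · exact h
        · exact h
        · exact h
        · exact h'.symm
        · exact absurd (h.trans h') (D.acyclic a)
        · exact absurd (hU h h'.1) h'.2
        · exact h'.symm
        · exact absurd (hU h' h.1) h.2
        · exact absurd h.1 h'.2 }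
  -- The completion is a linear extension restricted to neighbors: linearity gives totality, and
  -- antisymmetry gives acyclicity.
  obtain ⟨s, hs, hrs⟩ := extend_partialOrder r
  have strict : ∀ a b, Relation.TransGen (fun a b => D.Neighbors a b ∧ s a b) a b →
      s a b ∧ a ≠ b := by
    intro a b h
    induction h with
    | single h => exact ⟨h.2, h.1.1⟩
    | @tail b c _ h ih =>
      refine ⟨_root_.trans ih.1 h.2, ?_⟩
      rintro rfl
      exact h.1.1 (antisymm h.2 ih.1)
  have hpref : ∀ {a b}, D.Prefers a b → D.Neighbors a b := fun {a b} h =>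
    ⟨by rintro rfl; exact D.acyclic a (.single h), D.prefers_edge a b h⟩
  have hmem : ∀ {a b}, D.Neighbors a b → a ∈ D.facts ∧ b ∈ D.facts := fun h => by
    obtain ⟨-, e, he, ha, hb⟩ := h
    exact ⟨D.edges_subset e he ha, D.edges_subset e he hb⟩
  refine ⟨{ facts := D.facts
            edges := D.edges
            edges_subset := D.edges_subset
            Prefers := fun a b => D.Neighbors a b ∧ s a b
            prefers_mem := fun a b h => hmem h.1
            acyclic := fun a h => (strict a a h).2 rfl
            prefers_edge := fun a b h => h.1.2 }, ⟨rfl, rfl, ?_, ?_⟩, ?_⟩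
  · exact fun a b h => ⟨hpref h, hrs _ _ (Or.inr (Or.inl (.single h)))⟩
  · intro a b h
    have h' : D.Neighbors b a := ⟨h.1.symm, h.2.imp fun _ x => ⟨x.1, x.2.2, x.2.1⟩⟩
    exact (total_of s a b).imp (fun x => ⟨h, x⟩) fun x => ⟨h', x⟩
  · rintro g ⟨hn, hgf⟩
    by_cases hg : U g
    · exact (Relation.reflTransGen_iff_eq_or_transGen.1 hg).resolve_left fun h => hn.1 h.symm
    -- A fact that is not above `f` comes after `f`, so it cannot be preferred to `f`.
    · exact absurd (antisymm hgf (hrs _ _ (Or.inr (Or.inr ⟨.refl, hg⟩)))) hn.1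

theorem IsCompletion.consistent_iff {Dc : PrioritizingInstance S C} (h : D.IsCompletion Dc)
    (J : Finset (Fact S C)) : Dc.Consistent J ↔ D.Consistent J := by
  simp only [Consistent, h.1, h.2.1]

/-- An improvement for a relation remains one for every larger relation. -/
theorem cRepairs_subset_gRepairs (D : PrioritizingInstance S C) : D.cRepairs ⊆ D.gRepairs := by
  rintro J ⟨hJ, Dc, hDc, -, hno⟩
  refine ⟨hJ, ?_⟩
  rintro ⟨K, hK, -, hne, himp⟩
  refine hno ⟨K, (hDc.consistent_iff K).2 hK, (hDc.consistent_iff J).2 hJ, hne,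
    fun f hf hfK => ?_⟩
  obtain ⟨g, hg, hgJ, hgf⟩ := himp f hf hfK
  exact ⟨g, hg, hgJ, hDc.2.2.1 _ _ hgf⟩

theorem IsCompletion.exists_decisive {Dc : PrioritizingInstance S C} (h : D.IsCompletion Dc)
    (hne : ∅ ∉ D.edges) : ∃ G, Dc.Decisive G ∧ G ∈ D.cRepairs := by
  obtain ⟨G, hG⟩ := Total.exists_decisive h.2.2.2 (h.2.1 ▸ hne)
  exact ⟨G, hG, (h.consistent_iff G).1 hG.1, Dc, h, hG.gRepairs_eq ▸ rfl⟩

theorem cCategorical_of_gCategorical (h : D.GCategorical) : D.CCategorical := by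
  obtain ⟨G, hG⟩ := Set.ncard_eq_one.1 h
  have hGmem : G ∈ D.gRepairs := hG ▸ rfl
  have hne := hGmem.1.empty_notMem
  have hsub := hG ▸ D.cRepairs_subset_gRepairs
  by_cases hfacts : Nonempty (Fact S C)
  · obtain ⟨f⟩ := hfacts
    obtain ⟨Dc, hDc, -⟩ := D.exists_completion f
    obtain ⟨G', -, hG'⟩ := hDc.exists_decisive hne
    refine Set.ncard_eq_one.2 ⟨G, hsub.antisymm ?_⟩
    have := hsub hG'
    simp only [Set.mem_singleton_iff] at this
    simpa using this ▸ hG'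
  -- Without any fact there is no `f` for which `exists_completion` could be invoked, but then `D`
  -- is trivially its own completion.
  · have hD : D.IsCompletion D :=
      ⟨rfl, rfl, fun _ _ h => h, fun f => absurd ⟨f⟩ hfacts⟩
    exact Set.ncard_eq_one.2 ⟨G, hsub.antisymm
      (Set.singleton_subset_iff.2 ⟨hGmem.1, D, hD, hGmem⟩)⟩

/-- The completion is chosen separately for each excluded fact `f`, so that everything preferred to
`f` in it is already above `f` in `D`. Uniqueness of the c-repair forces all these completions to
have the same decisive set. -/
theorem Transitive.exists_decisive (ht : D.Transitive) (h : D.CCategorical) :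
    ∃ G, D.Decisive G := by
  obtain ⟨G, hG⟩ := Set.ncard_eq_one.1 h
  have hGmem : G ∈ D.cRepairs := hG ▸ rfl
  refine ⟨G, hGmem.1, fun f hf hfG => ?_⟩
  obtain ⟨Dc, hDc, hup⟩ := D.exists_completion f
  obtain ⟨G', hdec, hG'⟩ := hDc.exists_decisive hGmem.1.empty_notMem
  rw [hG, Set.mem_singleton_iff] at hG'
  subst hG'
  obtain ⟨e, he, hfe, hother⟩ := hdec.2 f (hDc.1 ▸ hf) hfG
  rw [hDc.2.1] at he
  refine ⟨e, he, hfe, fun g hg hgf => ⟨(hother g hg hgf).1, ?_⟩⟩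
  exact ht g f ⟨hgf, e, he, hg, hfe⟩ (hup g (hother g hg hgf).2)

theorem Decisive.gCategorical {G : Finset (Fact S C)} (hG : D.Decisive G) : D.GCategorical :=
  Set.ncard_eq_one.2 ⟨G, hG.gRepairs_eq⟩

theorem Transitive.gCategorical_iff (ht : D.Transitive) :
    D.GCategorical ↔ ∃ G, D.Decisive G :=
  ⟨fun h => ht.exists_decisive (cCategorical_of_gCategorical h), fun ⟨_, hG⟩ => hG.gCategorical⟩

theorem Transitive.gCategorical_iff_cCategorical (ht : D.Transitive) :
    D.GCategorical ↔ D.CCategorical :=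
  ⟨cCategorical_of_gCategorical, fun h => ht.gCategorical_iff.2 (ht.exists_decisive h)⟩

end PrioritizingInstance

end PrefRepair

/-! ### While programs on stacks and their compilation to multi-stack machines -/

namespace StackProg

open Turing StateTransition

/-- Programs that act on stacks indexed by `K` over the alphabet `A`, with registers `σ`. -/
inductive Prog (K A σ : Type)
  | push (k : K) (f : σ → A)
  | pop (k : K) (f : σ → Option A → σ)
  | load (f : σ → σ)
  | seq (p q : Prog K A σ)
  | ite (c : σ → Bool) (p q : Prog K A σ)
  /-- Pop from `k`; if the new registers satisfy `c`, run the body and repeat. -/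
  | loop (k : K) (f : σ → Option A → σ) (c : σ → Bool) (p : Prog K A σ)

variable {K A σ : Type} [DecidableEq K]

/-- `Runs p x y n`: started in the state `x`, the program `p` ends in `y` after at most `n` steps. -/
inductive Runs : Prog K A σ → σ × (K → List A) → σ × (K → List A) → ℕ → Prop
  | push (k f v s) : Runs (.push k f) (v, s) (v, Function.update s k (f v :: s k)) 1
  | pop (k f v s) :
      Runs (.pop k f) (v, s) (f v (s k).head?, Function.update s k (s k).tail) 1
  | load (f v s) : Runs (.load f) (v, s) (f v, s) 1
  | seq {p q x y z m n} : Runs p x y m → Runs q y z n → Runs (.seq p q) x z (m + n)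
  | ite_true {c p q x y n} : c x.1 = true → Runs p x y n → Runs (.ite c p q) x y (n + 1)
  | ite_false {c p q x y n} : c x.1 = false → Runs q x y n → Runs (.ite c p q) x y (n + 1)
  | loop_exit {k f c p v s} : c (f v (s k).head?) = false →
      Runs (.loop k f c p) (v, s) (f v (s k).head?, Function.update s k (s k).tail) 1
  | loop_next {k f c p v s y z m n} : c (f v (s k).head?) = true →
      Runs p (f v (s k).head?, Function.update s k (s k).tail) y m →
      Runs (.loop k f c p) y z n → Runs (.loop k f c p) (v, s) z (m + n + 1)
  | weaken {p x y m n} : Runs p x y m → m ≤ n → Runs p x y n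

/-- The labels of the machine code of a program. -/
def Label : Prog K A σ → Type
  | .push _ _ => Unit
  | .pop _ _ => Unit
  | .load _ => Unit
  | .seq p q => Label p ⊕ Label q
  | .ite _ p q => Unit ⊕ (Label p ⊕ Label q)
  | .loop _ _ _ p => Unit ⊕ Label p

/-- The label at which a program starts. -/
def entry : (p : Prog K A σ) → Label p
  | .push _ _ => ()
  | .pop _ _ => ()
  | .load _ => ()
  | .seq p _ => Sum.inl (entry p)
  | .ite _ _ _ => Sum.inl ()
  | .loop _ _ _ _ => Sum.inl ()

/-- The labels of a program are finitely many. -/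
@[reducible]
def labelFintype : (p : Prog K A σ) → Fintype (Label p)
  | .push _ _ => inferInstanceAs (Fintype Unit)
  | .pop _ _ => inferInstanceAs (Fintype Unit)
  | .load _ => inferInstanceAs (Fintype Unit)
  | .seq p q =>
    haveI := labelFintype p
    haveI := labelFintype q
    inferInstanceAs (Fintype (Label p ⊕ Label q))
  | .ite _ p q =>
    haveI := labelFintype p
    haveI := labelFintype q
    inferInstanceAs (Fintype (Unit ⊕ (Label p ⊕ Label q)))
  | .loop _ _ _ p =>
    haveI := labelFintype p
    inferInstanceAs (Fintype (Unit ⊕ Label p))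

/-- The alphabets of the compiled machine: the stacks of the program, an input stack and an output
stack. -/
abbrev Alphabet (K A I : Type) : K ⊕ Bool → Type
  | Sum.inl _ => A
  | Sum.inr false => I
  | Sum.inr true => Bool

/-- The machine code of a program. -/
def code (I Λ : Type) : (p : Prog K A σ) → (Label p → Λ) → Λ →
    Label p → TM2.Stmt (Alphabet K A I) Λ (σ × Option I)
  | .push k f, _, ex, _ => .push (.inl k) (fun v => f v.1) (.goto fun _ => ex)
  | .pop k f, _, ex, _ => .pop (.inl k) (fun v o => (f v.1 o, v.2)) (.goto fun _ => ex)
  | .load f, _, ex, _ => .load (fun v => (f v.1, v.2)) (.goto fun _ => ex)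
  | .seq p q, ι, ex, l =>
    match l with
    | .inl l => code I Λ p (fun l => ι (.inl l)) (ι (.inr (entry q))) l
    | .inr l => code I Λ q (fun l => ι (.inr l)) ex l
  | .ite c p q, ι, ex, l =>
    match l with
    | .inl _ => .branch (fun v => c v.1) (.goto fun _ => ι (.inr (.inl (entry p))))
        (.goto fun _ => ι (.inr (.inr (entry q))))
    | .inr (.inl l) => code I Λ p (fun l => ι (.inr (.inl l))) ex l
    | .inr (.inr l) => code I Λ q (fun l => ι (.inr (.inr l))) ex l
  | .loop k f c p, ι, ex, l =>
    match l with
    | .inl _ => .pop (.inl k) (fun v o => (f v.1 o, v.2))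
        (.branch (fun v => c v.1) (.goto fun _ => ι (.inr (entry p))) (.goto fun _ => ex))
    | .inr l => code I Λ p (fun l => ι (.inr l)) (ι (.inl ())) l

/-- The stacks of the compiled machine. -/
def joinStacks {I : Type} (s : K → List A) (i : List I) (o : List Bool) :
    (k : K ⊕ Bool) → List (Alphabet K A I k)
  | Sum.inl k => s k
  | Sum.inr false => i
  | Sum.inr true => o

theorem update_joinStacks_inl {I : Type} (s : K → List A) (i : List I) (o : List Bool) (k : K)
    (l : List A) : Function.update (joinStacks s i o) (.inl k) l =
      joinStacks (Function.update s k l) i o := by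
  funext j
  rcases j with j | j | j
  · by_cases h : j = k
    · subst h; simp [joinStacks]
    · simp [joinStacks, h, Function.update_of_ne]
  · simp [joinStacks, Function.update_of_ne]
  · simp [joinStacks, Function.update_of_ne]

theorem update_joinStacks_in {I : Type} (s : K → List A) (i l : List I) (o : List Bool) :
    Function.update (joinStacks s i o) (.inr false) l = joinStacks s l o := by
  funext j
  rcases j with j | j | j <;> simp [joinStacks, Function.update_of_ne]

theorem update_joinStacks_out {I : Type} (s : K → List A) (i : List I) (o l : List Bool) :
    Function.update (joinStacks s i o) (.inr true) l = joinStacks s i l := by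
  funext j
  rcases j with j | j | j <;> simp [joinStacks, Function.update_of_ne]

/-- Reachability in a bounded number of steps. -/
def Within {X : Type} (f : X → Option X) (a b : X) (n : ℕ) : Prop :=
  Nonempty (EvalsToInTime f a (some b) n)

theorem Within.trans {X : Type} {f : X → Option X} {a b c : X} {m n : ℕ} (h : Within f a b m)
    (h' : Within f b c n) : Within f a c (m + n) := by
  obtain ⟨h⟩ := h
  obtain ⟨h'⟩ := h'
  exact ⟨add_comm n m ▸ EvalsToInTime.trans f m n a b _ h h'⟩

theorem Within.mono {X : Type} {f : X → Option X} {a b : X} {m n : ℕ} (h : Within f a b m)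
    (hmn : m ≤ n) : Within f a b n := by
  obtain ⟨h⟩ := h
  exact ⟨⟨h.toEvalsTo, h.steps_le_m.trans hmn⟩⟩

theorem Within.single {X : Type} {f : X → Option X} {a b : X} (h : f a = some b) :
    Within f a b 1 :=
  ⟨⟨⟨1, by simpa [flip] using h⟩, le_rfl⟩⟩

theorem step_within {K' Λ σ' : Type} [DecidableEq K'] {Γ : K' → Type} {M : Λ → TM2.Stmt Γ Λ σ'}
    {l : Λ} {q : TM2.Stmt Γ Λ σ'} (h : M l = q) {v : σ'} {S : ∀ k, List (Γ k)}
    {c : TM2.Cfg Γ Λ σ'} (hc : TM2.stepAux q v S = c) : Within (TM2.step M) ⟨some l, v, S⟩ c 1 :=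
  .single (by simp [TM2.step, h, hc])

/-- The code of a compound program consists of the codes of its parts with other label embeddings
and exits, so the induction has to cover all of these. The body of a loop exits to the head of the
loop. -/
theorem Runs.within {I Λ : Type} (M : Λ → TM2.Stmt (Alphabet K A I) Λ (σ × Option I))
    {p : Prog K A σ} {x y : σ × (K → List A)} {n : ℕ} (h : Runs p x y n) (r : Option I)
    (i : List I) (o : List Bool) (ι : Label p → Λ) (ex : Λ)
    (hM : ∀ l, M (ι l) = code I Λ p ι ex l) :
    Within (TM2.step M) ⟨some (ι (entry p)), (x.1, r), joinStacks x.2 i o⟩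
      ⟨some ex, (y.1, r), joinStacks y.2 i o⟩ n := by
  induction h generalizing ex with
  | push k f v s =>
    refine step_within (hM ()) ?_
    simp [code, TM2.stepAux, update_joinStacks_inl, joinStacks]
  | pop k f v s =>
    refine step_within (hM ()) ?_
    simp [code, TM2.stepAux, update_joinStacks_inl, joinStacks]
  | load f v s =>
    refine step_within (hM ()) ?_
    simp [code, TM2.stepAux]
  | seq _ _ ih₁ ih₂ =>
    exact (ih₁ (fun l => ι (.inl l)) _ fun l => hM (.inl l)).trans
      (ih₂ (fun l => ι (.inr l)) _ fun l => hM (.inr l))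
  | ite_true hc _ ih =>
    rw [add_comm]
    refine Within.trans (step_within (hM (.inl ())) ?_)
      (ih (fun l => ι (.inr (.inl l))) _ fun l => hM (.inr (.inl l)))
    simp [code, TM2.stepAux, hc]
  | ite_false hc _ ih =>
    rw [add_comm]
    refine Within.trans (step_within (hM (.inl ())) ?_)
      (ih (fun l => ι (.inr (.inr l))) _ fun l => hM (.inr (.inr l)))
    simp [code, TM2.stepAux, hc]
  | loop_exit hc =>
    refine step_within (hM (.inl ())) ?_
    simp [code, TM2.stepAux, update_joinStacks_inl, joinStacks, hc]
  | loop_next hc _ _ ih₁ ih₂ =>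
    rw [add_comm]
    refine Within.trans (step_within (hM (.inl ())) ?_) (Within.trans
      (ih₁ (fun l => ι (.inr l)) (ι (.inl ())) fun l => hM (.inr l)) (ih₂ ι ex hM))
    simp [code, TM2.stepAux, update_joinStacks_inl, joinStacks, hc]
  | weaken _ hmn ih => exact (ih ι ex hM).mono hmn

attribute [instance] labelFintype

/-- The code of the compiled machine: it moves its input to the stack `k₀`, runs the program and
writes one bit of output. -/
def machineCode (I : Type) (p : Prog K A σ) (k₀ : K) (emb : I → A) (dflt : A) (v₀ : σ)
    (res : σ → Bool) :
    Label p ⊕ Bool → TM2.Stmt (Alphabet K A I) (Label p ⊕ Bool) (σ × Option I)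
  | .inl l => code I _ p Sum.inl (.inr true) l
  | .inr false => .pop (.inr false) (fun v o => (v.1, o))
      (.branch (fun v => v.2.isSome)
        (.push (.inl k₀) (fun v => v.2.elim dflt emb) (.goto fun _ => .inr false))
        (.goto fun _ => .inl (entry p)))
  | .inr true => .push (.inr true) (fun v => res v.1) (.load (fun _ => (v₀, none)) .halt)

/-- The compiled machine. -/
def machine [Fintype K] [Fintype σ] (I : Type) [Fintype I] (p : Prog K A σ) (k₀ : K) (emb : I → A)
    (dflt : A) (v₀ : σ) (res : σ → Bool) : FinTM2 where
  K := K ⊕ Bool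
  k₀ := .inr false
  k₁ := .inr true
  Γ := Alphabet K A I
  Λ := Label p ⊕ Bool
  main := .inr false
  σ := σ × Option I
  initialState := (v₀, none)
  Γk₀Fin := inferInstanceAs (Fintype I)
  m := machineCode I p k₀ emb dflt v₀ res

/-- Moving the word symbol by symbol reverses it, so the program finds the last input symbol on top.
-/
theorem machineCode_read (I : Type) (p : Prog K A σ) (k₀ : K)
    (emb : I → A) (dflt : A) (v₀ : σ) (res : σ → Bool) (w : List I) (r : Option I)
    (s : K → List A) :
    Within (TM2.step (machineCode I p k₀ emb dflt v₀ res))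
      ⟨some (.inr false), (v₀, r), joinStacks s w []⟩
      ⟨some (.inl (entry p)), (v₀, none),
        joinStacks (Function.update s k₀ ((w.map emb).reverse ++ s k₀)) [] []⟩ (w.length + 1) := by
  induction w generalizing s r with
  | nil =>
    refine step_within rfl ?_
    simp [machineCode, TM2.stepAux, joinStacks, update_joinStacks_in]
  | cons a w ih =>
    rw [List.length_cons, add_comm]
    refine Within.trans (step_within (c := ⟨some (.inr false), (v₀, some a),
      joinStacks (Function.update s k₀ (emb a :: s k₀)) w []⟩) rfl ?_) ?_
    · simp [machineCode, TM2.stepAux, joinStacks, update_joinStacks_in, update_joinStacks_inl]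
    · simpa using ih (some a) (Function.update s k₀ (emb a :: s k₀))

/-- A program that decides `f` within polynomial time gives a machine. -/
theorem polyTime_of_runs [Fintype K] [Fintype σ] {X I : Type} [Fintype I] (enc : X → List I)
    (f : X → Bool) (p : Prog K A σ) (k₀ : K) (emb : I → A) (dflt : A) (v₀ : σ) (res : σ → Bool)
    (time : Polynomial ℕ)
    (h : ∀ x, ∃ v, res v = f x ∧
      Runs p (v₀, Function.update (fun _ => []) k₀ ((enc x).map emb).reverse) (v, fun _ => [])
        (time.eval (enc x).length)) :
    Nonempty (TM2ComputableInPolyTime enc Computability.encodeBool f) := by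
  have key : ∀ x, Nonempty (TM2OutputsInTime (machine I p k₀ emb dflt v₀ res) (enc x)
      (some [f x]) ((Polynomial.X + 2 + time).eval (enc x).length)) := by
    intro x
    obtain ⟨v, hv, hr⟩ := h x
    have h₁ := machineCode_read I p k₀ emb dflt v₀ res (enc x) none (fun _ => [])
    have h₂ := hr.within (machineCode I p k₀ emb dflt v₀ res) none [] [] Sum.inl (.inr true)
      fun _ => rfl
    have h₃ : Within (TM2.step (machineCode I p k₀ emb dflt v₀ res))
        ⟨some (.inr true), (v, none), joinStacks (fun _ => []) [] []⟩
        ⟨none, (v₀, none), joinStacks (fun _ => []) [] [f x]⟩ 1 := by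
      refine step_within rfl ?_
      simp [machineCode, TM2.stepAux, joinStacks, update_joinStacks_out, hv]
    simp only [List.append_nil] at h₁
    -- Besides one step per symbol, reading takes one step to notice the end of the input and
    -- writing the answer takes another, hence `X + 2`.
    have h₄ := ((h₁.trans h₂).trans h₃).mono
      (n := (Polynomial.X + 2 + time).eval (enc x).length) (by simp)
    have e₁ : initList (machine I p k₀ emb dflt v₀ res) (enc x) =
        ⟨some (.inr false), (v₀, none), joinStacks (fun _ => []) (enc x) []⟩ := by
      refine congrArg _ (funext fun k => ?_)
      rcases k with k | k | k <;> rfl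
    -- A halting configuration must have the initial registers and only the output stack filled.
    -- This is why the registers are reset and the program has to empty its stacks.
    have e₂ : haltList (machine I p k₀ emb dflt v₀ res) [f x] =
        ⟨none, (v₀, none), joinStacks (fun _ => []) [] [f x]⟩ := by
      refine congrArg _ (funext fun k => ?_)
      rcases k with k | k | k <;> rfl
    unfold TM2OutputsInTime
    rw [e₁, Option.map_some, e₂]
    exact h₄
  refine ⟨{ tm := machine I p k₀ emb dflt v₀ res
            inputAlphabet := Equiv.refl I
            outputAlphabet := Equiv.refl Bool
            time := Polynomial.X + 2 + time
            outputsFun := fun x => ?_ }⟩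
  have h := (key x).some
  have e : enc x = List.map (Equiv.refl I).invFun (enc x) := (List.map_id _).symm
  exact (congrArg (fun l => TM2OutputsInTime (machine I p k₀ emb dflt v₀ res) l (some [f x])
    ((Polynomial.X + 2 + time).eval (enc x).length)) e) ▸ h

end StackProg

/-! ### Composition of runs, and loops split into iterations. -/

namespace StackProg

variable {K A σ : Type} [DecidableEq K]

namespace Runs

variable {p q : Prog K A σ} {x y z : σ × (K → List A)} {m n : ℕ}

theorem congr {y' : σ × (K → List A)} (h : Runs p x y m) (hy : y = y') (hmn : m ≤ n) :
    Runs p x y' n := hy ▸ h.weaken hmn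

theorem push_of {k : K} {f : σ → A} {v : σ} {s s' : K → List A}
    (h : Function.update s k (f v :: s k) = s') : Runs (.push k f) (v, s) (v, s') 1 :=
  h ▸ .push k f v s

theorem pop_of {k : K} {f : σ → Option A → σ} {v v' : σ} {s s' : K → List A}
    (hv : f v (s k).head? = v') (h : Function.update s k (s k).tail = s') :
    Runs (.pop k f) (v, s) (v', s') 1 :=
  h ▸ hv ▸ .pop k f v s

theorem load_of {f : σ → σ} {v v' : σ} {s : K → List A} (hv : f v = v') :
    Runs (.load f) (v, s) (v', s) 1 :=
  hv ▸ .load f v s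

end Runs

/-- Some complete iterations of a loop. -/
inductive Iter (k : K) (f : σ → Option A → σ) (c : σ → Bool) (p : Prog K A σ) :
    σ × (K → List A) → σ × (K → List A) → ℕ → Prop
  | refl (x) : Iter k f c p x x 0
  | step {v s v' s' y z m n} : c v' = true → f v (s k).head? = v' →
      Function.update s k (s k).tail = s' → Runs p (v', s') y m →
      Iter k f c p y z n → Iter k f c p (v, s) z (m + n + 1)
  | weaken {x y m n} : Iter k f c p x y m → m ≤ n → Iter k f c p x y n

namespace Iter

variable {k : K} {f : σ → Option A → σ} {c : σ → Bool} {p : Prog K A σ}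
  {x y z : σ × (K → List A)} {m n : ℕ}

theorem single {v v' s s'} (hc : c v' = true) (hv : f v (s k).head? = v')
    (hs : Function.update s k (s k).tail = s') (h : Runs p (v', s') y m) :
    Iter k f c p (v, s) y (m + 1) :=
  .step hc hv hs h (.refl y)

theorem trans (h : Iter k f c p x y m) (h' : Iter k f c p y z n) : Iter k f c p x z (m + n) := by
  induction h with
  | refl => simpa using h'
  | @step _ _ _ _ _ _ a b hc hv hs hp _ ih =>
    rw [show a + b + 1 + n = a + (b + n) + 1 by omega]
    exact .step hc hv hs hp (ih h')
  | weaken _ hmn ih => exact (ih h').weaken (by omega)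

theorem congr {y' : σ × (K → List A)} (h : Iter k f c p x y m) (hy : y = y') (hmn : m ≤ n) :
    Iter k f c p x y' n := hy ▸ h.weaken hmn

/-- The iterations are completed by the final pop, the one whose result violates the loop condition.
-/
theorem runs {v' s s'} (h : Iter k f c p x y m) (hv : f y.1 (y.2 k).head? = v')
    (hc : c v' = false) (hs : s = y.2) (hs' : Function.update s k (s k).tail = s')
    (hn : m + 1 ≤ n) :
    Runs (.loop k f c p) x (v', s') n := by
  refine Runs.weaken ?_ hn
  clear hn
  subst hs hs' hv
  induction h with
  | refl y => simpa using Runs.loop_exit hc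
  | @step _ _ _ _ _ _ a b hc' hv hs hp _ ih =>
    subst hv hs
    rw [show a + b + 1 + 1 = a + (b + 1) + 1 by omega]
    exact .loop_next hc' hp (ih hc)
  | weaken _ hmn ih => exact (ih hc).weaken (by omega)

end Iter

end StackProg

/-! ### The stacks and registers of the program, and moving symbols between stacks. -/

namespace PrefRepair

open StackProg

noncomputable instance : DecidableEq Sym := Classical.decEq _

instance : Fintype Sym where
  elems := ⟨[Sym.bit true, Sym.bit false, Sym.endString, Sym.endFact, Sym.endGroup,
    Sym.endSection], by simp⟩
  complete x := by rcases x with (_ | _) | _ | _ | _ | _ <;> simp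

/-- An input symbol together with two marks. The marks of the symbol `Sym.endFact` say whether the
fact is currently kept, and whether it is preferred to the fact under consideration. -/
abbrev Cell : Type := Sym × Bool × Bool

/-- An unmarked symbol. -/
def plain (a : Sym) : Cell := (a, false, false)

/-- The names of the stacks. -/
inductive Stack
  | input | facts | edges | prio | auxEdges | auxPrio | auxFacts | fact | upper | matched | count
  deriving DecidableEq

instance : Fintype Stack where
  elems := ⟨([.input, .facts, .edges, .prio, .auxEdges, .auxPrio, .auxFacts, .fact, .upper, .matched,
    .count] : List Stack), by simp⟩
  complete x := by cases x <;> simp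

/-- The registers: a symbol, the symbol to compare it with, whether all comparisons within the
current fact succeeded, and three flags. -/
structure Regs where
  reg : Option Cell
  other : Option Cell
  ok : Bool
  flags : Bool × Bool × Bool

noncomputable instance : Fintype Regs :=
  Fintype.ofInjective (fun r : Regs => (r.reg, r.other, r.ok, r.flags)) (by
    rintro ⟨_, _, _, _⟩ ⟨_, _, _, _⟩ h
    simpa using h)

abbrev Program : Type := Prog Stack Cell Regs

abbrev Memory : Type := Stack → List Cell

/-- The registers between the parts of the program. -/
def Regs.idle (fl : Bool × Bool × Bool) : Regs := ⟨none, none, true, fl⟩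

def Regs.set (v : Regs) (o : Option Cell) : Regs := { v with reg := o }

def Regs.val (v : Regs) : Cell := v.reg.getD (plain Sym.endSection)

/-- Move symbols satisfying `c` from one stack to another, and remove the next symbol. -/
def pourWhile (c : Cell → Bool) (a b : Stack) : Program :=
  .loop a Regs.set (fun v => v.reg.any c) (.push b Regs.val)

/-- Move symbols satisfying `c` from one stack to two others, and remove the next symbol. -/
def copyWhile (c : Cell → Bool) (a b b' : Stack) : Program :=
  .loop a Regs.set (fun v => v.reg.any c) (.seq (.push b Regs.val) (.push b' Regs.val))

/-- Move a whole stack. -/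
def pour (a b : Stack) : Program := pourWhile (fun _ => true) a b

/-- Empty a stack. -/
def clear (a : Stack) : Program := .loop a Regs.set (fun v => v.reg.isSome) (.load id)

/-- A pop and a push per moved symbol, and one more pop. That last pop removes the first symbol
violating `c` and leaves it in the register, where later commands read it. -/
theorem runs_pourWhile {c : Cell → Bool} {a b : Stack} (hab : a ≠ b) {v : Regs} {s : Memory}
    {l r : List Cell} (hl : ∀ x ∈ l, c x = true) (hr : r.head?.any c = false)
    (hs : s a = l ++ r) :
    Runs (pourWhile c a b) (v, s) (v.set r.head?,
      Function.update (Function.update s a r.tail) b (l.reverse ++ s b)) (2 * l.length + 1) := by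
  -- The register after the iterations need not be known exactly, as the next pop overwrites it.
  have key : ∃ v' : Regs, v'.set r.head? = v.set r.head? ∧
      Iter a Regs.set (fun v => v.reg.any c) (.push b Regs.val) (v, s)
        (v', Function.update (Function.update s a r) b (l.reverse ++ s b)) (2 * l.length) := by
    induction l generalizing v s with
    | nil =>
      refine ⟨v, rfl, ?_⟩
      have : Function.update (Function.update s a r) b (s b) = s := by
        rw [← Function.update_of_ne hab.symm r s, Function.update_eq_self]
        simp at hs
        rw [← hs, Function.update_eq_self]
      simpa [this] using Iter.refl _
    | cons x l ih =>
      obtain ⟨v', hv', h⟩ := ih (v := v.set (some x))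
        (s := Function.update (Function.update s a (l ++ r)) b (x :: s b))
        (fun y hy => hl y (by simp [hy])) (by simp [hab])
      refine ⟨v', hv'.trans rfl, ?_⟩
      have h1 : Iter a Regs.set (fun v => v.reg.any c) (.push b Regs.val) (v, s)
          (v.set (some x), Function.update (Function.update s a (l ++ r)) b (x :: s b)) 2 := by
        refine Iter.single (v' := v.set (some x)) (s' := Function.update s a (l ++ r))
          (by simpa [Regs.set] using hl x (by simp)) (by simp [hs]) (by simp [hs])
          (.push_of ?_)
        simp [Regs.set, Regs.val, hab.symm]
      have h2 := h1.trans h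
      simp only [List.length_cons]
      rw [show 2 * (l.length + 1) = 2 + 2 * l.length by ring]
      convert! h2 using 2
      funext j
      by_cases hb : j = b
      · subst hb; simp
      · by_cases ha : j = a
        · subst ha; simp [hb]
        · simp [ha, hb]
  obtain ⟨v', hv', h⟩ := key
  refine h.runs (by simpa [hab] using hv') (by simpa [Regs.set] using hr) rfl ?_ le_rfl
  funext j
  by_cases hb : j = b
  · subst hb; simp [hab.symm]
  · by_cases ha : j = a
    · subst ha; simp [hb]
    · simp [ha, hb]

theorem runs_copyWhile {c : Cell → Bool} {a b b' : Stack} (hab : a ≠ b) (hab' : a ≠ b')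
    (hbb' : b ≠ b') {v : Regs} {s : Memory}
    {l r : List Cell} (hl : ∀ x ∈ l, c x = true) (hr : r.head?.any c = false)
    (hs : s a = l ++ r) :
    Runs (copyWhile c a b b') (v, s) (v.set r.head?,
      Function.update (Function.update (Function.update s a r.tail) b (l.reverse ++ s b))
        b' (l.reverse ++ s b')) (3 * l.length + 1) := by
  have key : ∃ v' : Regs, v'.set r.head? = v.set r.head? ∧
      Iter a Regs.set (fun v => v.reg.any c) (.seq (.push b Regs.val) (.push b' Regs.val)) (v, s)
        (v', Function.update (Function.update (Function.update s a r) b (l.reverse ++ s b))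
          b' (l.reverse ++ s b')) (3 * l.length) := by
    induction l generalizing v s with
    | nil =>
      refine ⟨v, rfl, ?_⟩
      have : Function.update (Function.update (Function.update s a r) b (s b)) b' (s b') = s := by
        simp at hs
        funext j
        by_cases hb' : j = b'
        · subst hb'; simp
        · by_cases hb : j = b
          · subst hb; simp [hb']
          · by_cases ha : j = a
            · subst ha; simp [hb, hb', hs]
            · simp [ha, hb, hb']
      simpa [this] using Iter.refl _
    | cons x l ih =>
      obtain ⟨v', hv', h⟩ := ih (v := v.set (some x))
        (s := Function.update (Function.update (Function.update s a (l ++ r)) b (x :: s b))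
          b' (x :: s b'))
        (fun y hy => hl y (by simp [hy])) (by simp [hab, hab'])
      refine ⟨v', hv'.trans rfl, ?_⟩
      have h1 : Iter a Regs.set (fun v => v.reg.any c)
          (.seq (.push b Regs.val) (.push b' Regs.val)) (v, s)
          (v.set (some x), Function.update (Function.update (Function.update s a (l ++ r)) b
            (x :: s b)) b' (x :: s b')) 3 := by
        refine Iter.single (v' := v.set (some x)) (s' := Function.update s a (l ++ r))
          (by simpa [Regs.set] using hl x (by simp)) (by simp [hs]) (by simp [hs])
          (.seq (.push_of rfl) (.push_of ?_))
        simp [Regs.set, Regs.val, hab.symm, hab'.symm, hbb'.symm]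
      have h2 := h1.trans h
      simp only [List.length_cons]
      rw [show 3 * (l.length + 1) = 3 + 3 * l.length by ring]
      convert! h2 using 2
      funext j
      by_cases hb' : j = b'
      · subst hb'; simp
      · by_cases hb : j = b
        · subst hb; simp [hb']
        · by_cases ha : j = a
          · subst ha; simp [hb, hb']
          · simp [ha, hb, hb']
  obtain ⟨v', hv', h⟩ := key
  refine h.runs (by simpa [hab, hab'] using hv') (by simpa [Regs.set] using hr) rfl ?_ le_rfl
  funext j
  by_cases hb' : j = b'
  · subst hb'; simp [hab'.symm]
  · by_cases hb : j = b
    · subst hb; simp [hab.symm, hb']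
    · by_cases ha : j = a
      · subst ha; simp [hb, hb']
      · simp [ha, hb, hb']

theorem runs_pour {a b : Stack} (hab : a ≠ b) (v : Regs) (s : Memory) :
    Runs (pour a b) (v, s) (v.set none,
      Function.update (Function.update s a []) b ((s a).reverse ++ s b))
      (2 * (s a).length + 1) :=
  runs_pourWhile (r := []) hab (by simp) (by simp) (by simp)

theorem runs_clear (a : Stack) (v : Regs) (s : Memory) :
    Runs (clear a) (v, s) (v.set none, Function.update s a []) (2 * (s a).length + 1) := by
  generalize hl : s a = l
  induction l generalizing v s with
  | nil =>
    refine (Runs.loop_exit ?_).congr ?_ ?_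
    · simp [hl, Regs.set]
    · simp [hl]
    · simp
  | cons x l ih =>
    refine (Runs.loop_next ?_ (.load _ _ _) (ih _ _ ?_)).congr ?_ ?_
    · simp [hl, Regs.set]
    · simp [hl]
    · simp [Regs.set]
    · simp; omega

/-! ### Encoded lists of groups of facts -/

/-- Whether a symbol may occur within a fact. -/
def inFact (x : Cell) : Bool :=
  match x.1 with
  | Sym.bit _ => true
  | Sym.endString => true
  | _ => false

/-- The words that may occur as facts. -/
def IsWord (w : List Sym) : Prop := ∀ x ∈ w, inFact (plain x) = true

/-- The encoding of a fact with marks. -/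
def factCells (w : List Sym) (b : Bool × Bool) : List Cell := w.map plain ++ [(Sym.endFact, b)]

/-- The encoding of a group of facts whose marks are given by `h`. -/
def groupCells (h : List Sym → Bool × Bool) (l : List (List Sym)) : List Cell :=
  l.flatMap (fun w => factCells w (h w)) ++ [plain Sym.endGroup]

/-- The encoding of a list of groups of facts whose marks are given by `h`. -/
def tape (h : List Sym → Bool × Bool) (es : List (List (List Sym))) : List Cell :=
  es.flatMap (groupCells h)

/-- Copy the next fact of `t` to the stack `k`. -/
def loadFact (t y k : Stack) : Program :=
  .seq (copyWhile inFact t y .matched) (.seq (.push y Regs.val) (pour .matched k))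

/-- The copy passes through `.matched`, so it is reversed twice and arrives on `k` in its original
order. The end symbol, still in the register after the copying, goes to `y` only. -/
theorem runs_loadFact {t y k : Stack} (hty : t ≠ y) (ht : t ≠ .matched) (hy : y ≠ .matched)
    (hk : k ≠ .matched) (htk : t ≠ k) (hyk : y ≠ k) {v : Regs} {s : Memory} {w : List Sym}
    {b : Bool × Bool} {r : List Cell} (hw : IsWord w) (hs : s t = factCells w b ++ r)
    (hm : s .matched = []) (hsk : s k = []) :
    Runs (loadFact t y k) (v, s) (v.set none, Function.update (Function.update (Function.update s
      t r) y ((factCells w b).reverse ++ s y)) k (w.map plain)) (5 * w.length + 3) := by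
  have hc := runs_copyWhile (c := inFact) (v := v) (r := (Sym.endFact, b) :: r) hty ht hy
    (l := w.map plain) (s := s)
    (by simpa [IsWord] using hw) (by simp [inFact]) (by simp [hs, factCells])
  refine (hc.seq (.seq (.push _ _ _ _) (runs_pour hk.symm _ _))).congr ?_ ?_
  · refine Prod.ext rfl ?_
    funext j
    by_cases h1 : j = .matched
    · subst h1; simp [hm, hk.symm, ht.symm, hy.symm]
    · by_cases h2 : j = k
      · subst h2; simp [h1, hm, hsk, hyk.symm, htk.symm, hy.symm]
      · by_cases h3 : j = y
        · subst h3; simp [h1, h2, hm, factCells, Regs.set, Regs.val]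
        · simp [h1, h2, h3, Function.update_apply]
  · simp [hm, hy.symm]
    omega

end PrefRepair

/-! ### Sweeps: comparing all facts of a list with a given word. -/

namespace PrefRepair

open StackProg

/-- Compare the current symbol with the next symbol of the stack to be matched. At the end of a
fact, the comparison is complete: the marks are updated by `upd` and the flags by `atFact`. -/
noncomputable def Regs.compare (upd : Bool → Bool × Bool → Bool × Bool)
    (atFact : Bool → Bool × Bool → Bool × Bool × Bool → Bool × Bool × Bool)
    (v : Regs) (o : Option Cell) : Regs :=
  if v.val.1 = Sym.endFact then
    ⟨some (Sym.endFact, upd (v.ok && o.isNone) v.val.2), o, true,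
      atFact (v.ok && o.isNone) v.val.2 v.flags⟩
  else { v with other := o, ok := v.ok && decide (o.map Prod.fst = some v.val.1) }

/-- Store the symbol that was compared. -/
def stash : Program :=
  .ite (fun v => v.other.isSome)
    (.seq (.push .matched fun v => v.other.getD (plain Sym.endSection))
      (.load fun v => { v with other := none }))
    (.load id)

/-- Process one symbol of a list of groups, comparing its facts with the contents of `k`. -/
noncomputable def sweepStep (k : Stack) (upd : Bool → Bool × Bool → Bool × Bool)
    (atFact : Bool → Bool × Bool → Bool × Bool × Bool → Bool × Bool × Bool)
    (atGroup : Bool × Bool × Bool → Bool × Bool × Bool) : Program :=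
  .ite (fun v => decide (v.val.1 = Sym.endGroup))
    (.seq (.push .auxEdges Regs.val)
      (.load fun v => { v with reg := none, flags := atGroup v.flags }))
    (.seq (.pop k (Regs.compare upd atFact))
      (.seq stash
        (.seq (.push .auxEdges Regs.val)
          (.ite (fun v => decide (v.val.1 = Sym.endFact))
            (pour .matched k) (.load fun v => v.set none)))))

/-- Process a list of groups, comparing its facts with the contents of `k`. -/
noncomputable def sweep (t k : Stack) (upd : Bool → Bool × Bool → Bool × Bool)
    (atFact : Bool → Bool × Bool → Bool × Bool × Bool → Bool × Bool × Bool)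
    (atGroup : Bool × Bool × Bool → Bool × Bool × Bool) : Program :=
  .seq (.loop t Regs.set (fun v => v.reg.isSome) (sweepStep k upd atFact atGroup))
    (pour .auxEdges t)

/-- The memory during a sweep of `t` against `k`. -/
def sweepMem (s : Memory) (t k : Stack) (a x c d : List Cell) : Memory := fun j =>
  if j = t then a else if j = .auxEdges then x else if j = k then c else if j = .matched then d
  else s j

/-- The stacks of a sweep are different. -/
structure SweepStacks (t k : Stack) : Prop where
  ta : t ≠ .auxEdges
  tk : t ≠ k
  tm : t ≠ .matched
  ka : k ≠ .auxEdges
  km : k ≠ .matched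

section sweepMem

variable {s : Memory} {t k : Stack} (h : SweepStacks t k) (a x c d l : List Cell)

@[simp]
theorem sweepMem_tape : sweepMem s t k a x c d t = a := by simp [sweepMem]

theorem update_sweepMem_tape :
    Function.update (sweepMem s t k a x c d) t l = sweepMem s t k l x c d := by
  funext j; by_cases hj : j = t <;> simp [sweepMem, hj]

include h

theorem sweepMem_aux : sweepMem s t k a x c d .auxEdges = x := by simp [sweepMem, h.ta.symm]

theorem sweepMem_key : sweepMem s t k a x c d k = c := by simp [sweepMem, h.tk.symm, h.ka]

theorem sweepMem_matched : sweepMem s t k a x c d .matched = d := by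
  simp [sweepMem, h.tm.symm, h.km.symm]

theorem update_sweepMem_aux :
    Function.update (sweepMem s t k a x c d) .auxEdges l = sweepMem s t k a l c d := by
  funext j; by_cases hj : j = .auxEdges <;> simp [sweepMem, hj, h.ta.symm]

theorem update_sweepMem_key :
    Function.update (sweepMem s t k a x c d) k l = sweepMem s t k a x l d := by
  funext j; by_cases hj : j = k <;> simp [sweepMem, hj, h.tk.symm, h.ka]

theorem update_sweepMem_matched :
    Function.update (sweepMem s t k a x c d) .matched l = sweepMem s t k a x c l := by
  funext j; by_cases hj : j = .matched <;> simp [sweepMem, hj, h.tm.symm, h.km.symm]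

end sweepMem

section sweep

variable {s : Memory} {t k : Stack} (hst : SweepStacks t k)
  {upd : Bool → Bool × Bool → Bool × Bool}
  {atFact : Bool → Bool × Bool → Bool × Bool × Bool → Bool × Bool × Bool}
  {atGroup : Bool × Bool × Bool → Bool × Bool × Bool}

/-- Iterations of the loop of a sweep. -/
abbrev SweepIter (t k : Stack) (upd : Bool → Bool × Bool → Bool × Bool)
    (atFact : Bool → Bool × Bool → Bool × Bool × Bool → Bool × Bool × Bool)
    (atGroup : Bool × Bool × Bool → Bool × Bool × Bool) :=
  Iter t Regs.set (fun v => v.reg.isSome) (sweepStep k upd atFact atGroup)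

include hst

theorem runs_stash (r : Option Cell) (ok : Bool) (fl : Bool × Bool × Bool) (a l : List Cell)
    (c : List Sym) (d e : List Cell) :
    Runs stash (⟨r, c.head?.map plain, ok, fl⟩, sweepMem s t k a l e d)
      (⟨r, none, ok, fl⟩, sweepMem s t k a l e ((c.take 1).map plain ++ d)) 3 := by
  cases c with
  | nil => exact (Runs.ite_false rfl (.load _ _ _)).congr (by simp) (by simp)
  | cons y c =>
    exact .ite_true rfl (.seq (.push_of (by
      simp [sweepMem_matched hst, update_sweepMem_matched hst])) (.load_of rfl))

theorem sweepIter_symbol {x : Sym} (hx : inFact (plain x) = true) (r : Option Cell) (ok : Bool)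
    (fl : Bool × Bool × Bool) (a l : List Cell) (c : List Sym) (d : List Cell) :
    SweepIter t k upd atFact atGroup
      (⟨r, none, ok, fl⟩, sweepMem s t k (plain x :: a) l (c.map plain) d)
      (⟨none, none, ok && decide (c.head? = some x), fl⟩,
        sweepMem s t k a (plain x :: l) (c.tail.map plain) ((c.take 1).map plain ++ d)) 9 := by
  have h1 : x ≠ Sym.endGroup := by rintro rfl; simp [inFact, plain] at hx
  have h2 : x ≠ Sym.endFact := by rintro rfl; simp [inFact, plain] at hx
  refine Iter.single (v' := ⟨some (plain x), none, ok, fl⟩)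
    (s' := sweepMem s t k a l (c.map plain) d) rfl (by simp [Regs.set])
    (by simp [update_sweepMem_tape]) (m := 8) (.ite_false (by simp [Regs.val, plain, h1]) ?_)
  have hpop : Runs (.pop k (Regs.compare upd atFact))
      (⟨some (plain x), none, ok, fl⟩, sweepMem s t k a l (c.map plain) d)
      (⟨some (plain x), c.head?.map plain, ok && decide (c.head? = some x), fl⟩,
        sweepMem s t k a l (c.tail.map plain) d) 1 := by
    refine .pop_of ?_ ?_
    · cases c <;> simp [Regs.compare, Regs.val, plain, h2, sweepMem_key hst]
    · simp [sweepMem_key hst, update_sweepMem_key hst]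
  refine (hpop.seq ((runs_stash hst _ _ _ _ _ _ _ _).seq (.seq (.push_of (s' := sweepMem s t k a (plain x :: l)
    (c.tail.map plain) ((c.take 1).map plain ++ d)) ?_)
    (.ite_false (by simp [Regs.val, plain, h2]) (.load_of rfl)))))
  simp [Regs.val, sweepMem_aux hst, update_sweepMem_aux hst]

/-- Here `c'` is the consumed part of the key and `c` the rest. The pop at the end of a fact tests
whether the key is exhausted; if it removes a symbol, that symbol is stashed like the others, and
pouring back restores the whole key. -/
theorem sweepIter_endFact (r : Option Cell) (ok : Bool) (b : Bool × Bool)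
    (fl : Bool × Bool × Bool) (a l : List Cell) (c c' : List Sym) :
    SweepIter t k upd atFact atGroup
      (⟨r, none, ok, fl⟩,
        sweepMem s t k ((Sym.endFact, b) :: a) l (c.map plain) (c'.map plain).reverse)
      (⟨none, none, true, atFact (ok && c.isEmpty) b fl⟩,
        sweepMem s t k a ((Sym.endFact, upd (ok && c.isEmpty) b) :: l) ((c' ++ c).map plain) [])
      (2 * (c' ++ c).length + 10) := by
  refine Iter.single (v' := ⟨some (Sym.endFact, b), none, ok, fl⟩)
    (s' := sweepMem s t k a l (c.map plain) (c'.map plain).reverse) rfl (by simp [Regs.set])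
    (by simp [update_sweepMem_tape]) (.ite_false (n := 2 * (c' ++ c).length + 8)
      (by simp [Regs.val]) ?_)
  have hpop : Runs (.pop k (Regs.compare upd atFact))
      (⟨some (Sym.endFact, b), none, ok, fl⟩,
        sweepMem s t k a l (c.map plain) (c'.map plain).reverse)
      (⟨some (Sym.endFact, upd (ok && c.isEmpty) b), c.head?.map plain, true,
        atFact (ok && c.isEmpty) b fl⟩,
        sweepMem s t k a l (c.tail.map plain) (c'.map plain).reverse) 1 := by
    refine .pop_of ?_ ?_
    · cases c <;> simp [Regs.compare, Regs.val, sweepMem_key hst]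
    · simp [sweepMem_key hst, update_sweepMem_key hst]
  refine (hpop.seq ((runs_stash hst _ _ _ _ _ _ _ _).seq (.seq (.push_of (s' := sweepMem s t k a
    ((Sym.endFact, upd (ok && c.isEmpty) b) :: l)
    (c.tail.map plain) ((c.take 1).map plain ++ (c'.map plain).reverse)) ?_)
    (.ite_true (by simp [Regs.val]) (runs_pour hst.km.symm _ _))))).congr ?_ ?_
  · simp [Regs.val, sweepMem_aux hst, update_sweepMem_aux hst]
  · cases c <;> simp [Regs.set, sweepMem_matched hst, sweepMem_key hst, update_sweepMem_matched hst,
      update_sweepMem_key hst]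
  · cases c <;> simp [sweepMem_matched hst] <;> omega

/-- The key may be shorter than `w`. Pops from the empty stack then make the comparison fail, in
accordance with `c.take w.length ≠ w`. -/
theorem sweepIter_word {w : List Sym} (hw : IsWord w) (ok : Bool)
    (fl : Bool × Bool × Bool) (a l : List Cell) (c c' : List Sym) :
    SweepIter t k upd atFact atGroup
      (⟨none, none, ok, fl⟩,
        sweepMem s t k (w.map plain ++ a) l (c.map plain) (c'.map plain).reverse)
      (⟨none, none, ok && decide (c.take w.length = w), fl⟩,
        sweepMem s t k a ((w.map plain).reverse ++ l) ((c.drop w.length).map plain)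
          ((c' ++ c.take w.length).map plain).reverse) (9 * w.length) := by
  induction w generalizing ok l c c' with
  | nil => simpa using Iter.refl _
  | cons x w ih =>
    have h1 := sweepIter_symbol (s := s) hst (upd := upd) (atFact := atFact) (atGroup := atGroup)
      (hw x (by simp)) none ok fl (w.map plain ++ a) l c (c'.map plain).reverse
    have h2 := ih (fun y hy => hw y (by simp [hy])) (ok && decide (c.head? = some x))
      (plain x :: l) c.tail (c' ++ c.take 1)
    rw [List.length_cons, mul_add, mul_one, add_comm (9 * w.length)]
    cases c with
    | nil =>
      refine (h1.trans (by simpa using h2)).congr ?_ le_rfl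
      simp
    | cons y c =>
      refine (h1.trans (by simpa using h2)).congr ?_ le_rfl
      simp [Bool.and_assoc]
      congr

theorem sweepIter_fact {w : List Sym} (hw : IsWord w) (b : Bool × Bool)
    (fl : Bool × Bool × Bool) (a l : List Cell) (c : List Sym) :
    SweepIter t k upd atFact atGroup
      (Regs.idle fl, sweepMem s t k (factCells w b ++ a) l (c.map plain) [])
      (Regs.idle (atFact (decide (w = c)) b fl),
        sweepMem s t k a ((factCells w (upd (decide (w = c)) b)).reverse ++ l) (c.map plain) [])
      (9 * w.length + (2 * c.length + 10)) := by
  have h1 := sweepIter_word (s := s) hst (upd := upd) (atFact := atFact) (atGroup := atGroup)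
    hw true fl ((Sym.endFact, b) :: a) l c []
  have h2 := sweepIter_endFact (s := s) hst (upd := upd) (atFact := atFact) (atGroup := atGroup)
    none (decide (c.take w.length = w)) b fl a ((w.map plain).reverse ++ l) (c.drop w.length)
    (c.take w.length)
  -- The words agree exactly if all symbols of `w` were matched and nothing of the key is left.
  have heq : (decide (c.take w.length = w) && (c.drop w.length).isEmpty) = decide (w = c) := by
    rw [Bool.eq_iff_iff]
    simp only [Bool.and_eq_true, decide_eq_true_eq, List.isEmpty_iff]
    constructor
    · rintro ⟨h, h'⟩
      rw [← List.take_append_drop w.length c, h, h', List.append_nil]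
    · rintro rfl
      simp
  rw [heq, List.take_append_drop] at h2
  simpa [factCells, Regs.idle] using h1.trans (by simpa using h2)

theorem sweepIter_facts {h : List Sym → Bool × Bool} {g : List (List Sym)}
    (hg : ∀ w ∈ g, IsWord w) (fl : Bool × Bool × Bool) (a l : List Cell) (c : List Sym) :
    SweepIter t k upd atFact atGroup
      (Regs.idle fl, sweepMem s t k (g.flatMap (fun w => factCells w (h w)) ++ a) l (c.map plain) [])
      (Regs.idle (g.foldl (fun fl w => atFact (decide (w = c)) (h w) fl) fl),
        sweepMem s t k a ((g.flatMap fun w => factCells w (upd (decide (w = c)) (h w))).reverse ++ l)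
          (c.map plain) [])
      ((2 * c.length + 10) * (g.flatMap fun w => factCells w (h w)).length) := by
  induction g generalizing fl l with
  | nil => simpa using Iter.refl _
  | cons w g ih =>
    have h1 := sweepIter_fact (s := s) hst (upd := upd) (atFact := atFact) (atGroup := atGroup)
      (hg w (by simp)) (h w) fl (g.flatMap (fun w => factCells w (h w)) ++ a) l c
    have h2 := ih (fun w hw => hg w (by simp [hw])) (atFact (decide (w = c)) (h w) fl)
      ((factCells w (upd (decide (w = c)) (h w))).reverse ++ l)
    rw [List.flatMap_cons, List.append_assoc]
    refine (h1.trans h2).congr ?_ ?_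
    · simp
    · simp [factCells]
      nlinarith

theorem sweepIter_group {h : List Sym → Bool × Bool} {g : List (List Sym)}
    (hg : ∀ w ∈ g, IsWord w) (fl : Bool × Bool × Bool) (a l : List Cell) (c : List Sym) :
    SweepIter t k upd atFact atGroup
      (Regs.idle fl, sweepMem s t k (groupCells h g ++ a) l (c.map plain) [])
      (Regs.idle (atGroup (g.foldl (fun fl w => atFact (decide (w = c)) (h w) fl) fl)),
        sweepMem s t k a ((groupCells (fun w => upd (decide (w = c)) (h w)) g).reverse ++ l)
          (c.map plain) [])
      ((2 * c.length + 10) * (groupCells h g).length) := by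
  have h1 := sweepIter_facts (s := s) hst (upd := upd) (atFact := atFact) (atGroup := atGroup)
    (h := h) hg fl (plain Sym.endGroup :: a) l c
  have h2 : ∀ fl l, SweepIter t k upd atFact atGroup
      (Regs.idle fl, sweepMem s t k (plain Sym.endGroup :: a) l (c.map plain) [])
      (Regs.idle (atGroup fl), sweepMem s t k a (plain Sym.endGroup :: l) (c.map plain) []) 4 := by
    intro fl l
    refine Iter.single (v' := ⟨some (plain Sym.endGroup), none, true, fl⟩)
      (s' := sweepMem s t k a l (c.map plain) []) rfl (by simp [Regs.set, Regs.idle])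
      (by simp [update_sweepMem_tape]) (.ite_true (by simp [Regs.val, plain])
        (.seq (.push_of ?_) (.load_of rfl)))
    simp [sweepMem_aux hst, update_sweepMem_aux hst, Regs.val]
  rw [groupCells, List.append_assoc]
  refine (h1.trans (h2 _ _)).congr ?_ ?_
  · simp [groupCells]
  · simp
    nlinarith

theorem sweepIter_tape {h : List Sym → Bool × Bool} {es : List (List (List Sym))}
    (hes : ∀ g ∈ es, ∀ w ∈ g, IsWord w) (fl : Bool × Bool × Bool) (l : List Cell) (c : List Sym) :
    SweepIter t k upd atFact atGroup
      (Regs.idle fl, sweepMem s t k (tape h es) l (c.map plain) [])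
      (Regs.idle (es.foldl (fun fl g =>
          atGroup (g.foldl (fun fl w => atFact (decide (w = c)) (h w) fl) fl)) fl),
        sweepMem s t k [] ((tape (fun w => upd (decide (w = c)) (h w)) es).reverse ++ l)
          (c.map plain) [])
      ((2 * c.length + 10) * (tape h es).length) := by
  induction es generalizing fl l with
  | nil => simpa [tape] using Iter.refl _
  | cons g es ih =>
    have h1 := sweepIter_group (s := s) hst (upd := upd) (atFact := atFact) (atGroup := atGroup)
      (h := h) (hes g (by simp)) fl (tape h es) l c
    refine (h1.trans (ih (fun g hg => hes g (by simp [hg])) _ _)).congr ?_ ?_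
    · simp [tape]
    · simp [tape, mul_add]

/-- The key and the auxiliary stacks are restored, so the only effects are new marks on the tape and
a fold over the flags. Each use of a sweep is specified by choosing `upd`, `atFact` and `atGroup`.
-/
theorem runs_sweep {h : List Sym → Bool × Bool} {es : List (List (List Sym))}
    (hes : ∀ g ∈ es, ∀ w ∈ g, IsWord w) (fl : Bool × Bool × Bool) {c : List Sym}
    (ht : s t = tape h es) (hx : s .auxEdges = []) (hk : s k = c.map plain)
    (hm : s .matched = []) :
    Runs (sweep t k upd atFact atGroup) (Regs.idle fl, s)
      (Regs.idle (es.foldl (fun fl g =>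
          atGroup (g.foldl (fun fl w => atFact (decide (w = c)) (h w) fl) fl)) fl),
        Function.update s t (tape (fun w => upd (decide (w = c)) (h w)) es))
      ((2 * c.length + 14) * ((tape h es).length + 1)) := by
  -- Marks do not influence the length of a tape.
  have hlen : ∀ h', (tape h' es).length = (tape h es).length := by
    intro h'
    simp [tape, groupCells, factCells, List.length_flatMap]
  have h1 := sweepIter_tape (s := s) hst (upd := upd) (atFact := atFact) (atGroup := atGroup)
    (h := h) hes fl [] c
  have h0 : sweepMem s t k (tape h es) [] (c.map plain) [] = s := by
    funext j
    unfold sweepMem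
    split_ifs with h1 h2 h3 h4
    · rw [h1, ht]
    · rw [h2, hx]
    · rw [h3, hk]
    · rw [h4, hm]
    · rfl
  rw [h0] at h1
  refine ((h1.runs rfl ?_ rfl rfl le_rfl).seq (runs_pour hst.ta.symm _ _)).congr ?_ ?_
  · simp [Regs.set]
  · refine Prod.ext (by simp [Regs.set, Regs.idle]) ?_
    simp only [update_sweepMem_tape, List.tail_nil, sweepMem_tape, update_sweepMem_aux hst,
      sweepMem_aux hst, List.append_nil, List.reverse_reverse]
    funext j
    unfold sweepMem
    by_cases h1 : j = t
    · subst h1; simp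
    · simp only [h1, if_false, Function.update_of_ne, ne_eq, not_false_eq_true]
      split_ifs with h2 h3 h4
      · rw [h2, hx]
      · rw [h3, hk]
      · rw [h4, hm]
      · rfl
  · simp [update_sweepMem_tape, sweepMem_aux hst, hlen]
    nlinarith

end sweep

end PrefRepair

/-! ### Memory layouts, and marking the facts preferred to the current one. -/

namespace PrefRepair

open StackProg

/-- The contents of the stacks between the parts of the program. -/
structure Layout where
  input : List Cell
  facts : List Cell
  edges : List Cell
  prio : List Cell
  auxPrio : List Cell
  auxFacts : List Cell
  fact : List Cell
  upper : List Cell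
  count : List Cell

namespace Layout

/-- The memory that is described by a layout. -/
def mem (m : Layout) : Memory
  | .input => m.input
  | .facts => m.facts
  | .edges => m.edges
  | .prio => m.prio
  | .auxEdges => []
  | .auxPrio => m.auxPrio
  | .auxFacts => m.auxFacts
  | .fact => m.fact
  | .upper => m.upper
  | .matched => []
  | .count => m.count

variable (m : Layout) (l : List Cell)

@[simp] theorem mem_input : m.mem .input = m.input := rfl
@[simp] theorem mem_facts : m.mem .facts = m.facts := rfl
@[simp] theorem mem_edges : m.mem .edges = m.edges := rfl
@[simp] theorem mem_prio : m.mem .prio = m.prio := rfl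
@[simp] theorem mem_auxEdges : m.mem .auxEdges = [] := rfl
@[simp] theorem mem_auxPrio : m.mem .auxPrio = m.auxPrio := rfl
@[simp] theorem mem_auxFacts : m.mem .auxFacts = m.auxFacts := rfl
@[simp] theorem mem_fact : m.mem .fact = m.fact := rfl
@[simp] theorem mem_upper : m.mem .upper = m.upper := rfl
@[simp] theorem mem_matched : m.mem .matched = [] := rfl
@[simp] theorem mem_count : m.mem .count = m.count := rfl

@[simp] theorem update_input : Function.update m.mem .input l = { m with input := l }.mem := by
  funext j; cases j <;> rfl
@[simp] theorem update_facts : Function.update m.mem .facts l = { m with facts := l }.mem := by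
  funext j; cases j <;> rfl
@[simp] theorem update_edges : Function.update m.mem .edges l = { m with edges := l }.mem := by
  funext j; cases j <;> rfl
@[simp] theorem update_prio : Function.update m.mem .prio l = { m with prio := l }.mem := by
  funext j; cases j <;> rfl
@[simp] theorem update_auxPrio :
    Function.update m.mem .auxPrio l = { m with auxPrio := l }.mem := by
  funext j; cases j <;> rfl
@[simp] theorem update_auxFacts :
    Function.update m.mem .auxFacts l = { m with auxFacts := l }.mem := by
  funext j; cases j <;> rfl
@[simp] theorem update_fact : Function.update m.mem .fact l = { m with fact := l }.mem := by
  funext j; cases j <;> rfl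
@[simp] theorem update_upper : Function.update m.mem .upper l = { m with upper := l }.mem := by
  funext j; cases j <;> rfl
@[simp] theorem update_count : Function.update m.mem .count l = { m with count := l }.mem := by
  funext j; cases j <;> rfl

end Layout

/-- Flags are kept. -/
def keepFlags (_ : Bool) (_ : Bool × Bool) (fl : Bool × Bool × Bool) : Bool × Bool × Bool := fl

theorem foldl_keepFlags {α : Type} (es : List (List α)) (P : α → Bool) (h : α → Bool × Bool)
    (fl : Bool × Bool × Bool) :
    es.foldl (fun fl g => id (g.foldl (fun fl w => keepFlags (P w) (h w) fl) fl)) fl = fl := by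
  have h1 : ∀ (g : List α) fl, g.foldl (fun fl w => keepFlags (P w) (h w) fl) fl = fl := by
    intro g fl
    induction g generalizing fl with
    | nil => rfl
    | cons w g ih => exact ih _
  induction es generalizing fl with
  | nil => rfl
  | cons g es ih => rw [List.foldl_cons, h1]; exact ih _

/-- The priority pairs as groups of two facts. -/
def pairGroups (ps : List (List Sym × List Sym)) : List (List (List Sym)) :=
  ps.map fun p => [p.1, p.2]

/-- For the next pair, if its second fact is marked, then mark the occurrences of the first fact in
the hyperedges. -/
noncomputable def markUpperPair : Program :=
  -- The loop test has already popped the first symbol of the pair, so it is put back.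
  .seq (.push .prio Regs.val)
  (.seq (loadFact .prio .auxPrio .upper)
  (.seq (pourWhile inFact .prio .auxPrio)
  (.seq (.push .auxPrio Regs.val)
  (.seq (.ite (fun v => v.val.2.2)
    (.seq (.load fun v => v.set none)
      (sweep .edges .upper (fun eq b => (b.1, b.2 || eq)) keepFlags id))
    (.load id))
  (.seq (.pop .prio Regs.set)
  (.seq (.push .auxPrio Regs.val) (clear .upper)))))))

/-- For all pairs in which the second fact is marked, mark the occurrences of the first fact in the
hyperedges. -/
noncomputable def markUpper : Program :=
  .loop .prio Regs.set (fun v => v.reg.isSome) markUpperPair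

theorem iter_markUpper {m : Layout} {M : ℕ} {h hp : List Sym → Bool × Bool}
    {es : List (List (List Sym))} {g f : List Sym} {rest : List Cell} {fl : Bool × Bool × Bool}
    (hes : ∀ l ∈ es, ∀ w ∈ l, IsWord w) (hg : IsWord g) (hf : IsWord f)
    (hE : m.edges = tape h es) (hP : m.prio = groupCells hp [g, f] ++ rest)
    (hu : m.upper = []) (hM : (tape h es).length < M) (hgM : g.length < M) (hfM : f.length < M) :
    Iter .prio Regs.set (fun v => v.reg.isSome) markUpperPair
      (Regs.idle fl, m.mem)
      (Regs.idle fl, { m with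
        prio := rest
        auxPrio := (groupCells hp [g, f]).reverse ++ m.auxPrio
        edges := tape (fun w => ((h w).1, (h w).2 || ((hp f).2 && decide (w = g)))) es }.mem)
      (60 * M ^ 2) := by
  obtain ⟨x, l, hx⟩ : ∃ x l, m.prio = x :: l := by
    cases h : m.prio with
    | nil => simp [h, groupCells] at hP
    | cons x l => exact ⟨x, l, rfl⟩
  have h1 : Runs (.push .prio Regs.val) ((Regs.idle fl).set (some x), { m with prio := l }.mem)
      ((Regs.idle fl).set (some x), m.mem) 1 :=
    .push_of (by simp [Regs.val, Regs.set, ← hx])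
  have h2 := runs_loadFact (t := .prio) (y := .auxPrio) (k := .upper) (by decide) (by decide)
    (by decide) (by decide) (by decide) (by decide) (v := (Regs.idle fl).set (some x))
    (s := m.mem) (w := g) (b := hp g) (r := factCells f (hp f) ++ plain Sym.endGroup :: rest) hg
    (by simp [hP, groupCells]) rfl hu
  have h3 := runs_pourWhile (c := inFact) (a := .prio) (b := .auxPrio) (by decide)
    (v := (Regs.idle fl).set none)
    (s := { m with
      prio := factCells f (hp f) ++ plain Sym.endGroup :: rest
      auxPrio := (factCells g (hp g)).reverse ++ m.auxPrio
      upper := g.map plain }.mem) (l := f.map plain)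
    (r := (Sym.endFact, hp f) :: plain Sym.endGroup :: rest) (by simpa [IsWord] using hf)
    (by simp [inFact]) (by simp [factCells])
  have h4 : Runs (.push .auxPrio Regs.val) ((Regs.idle fl).set (some (Sym.endFact, hp f)),
      { m with
        prio := plain Sym.endGroup :: rest
        auxPrio := (f.map plain).reverse ++ ((factCells g (hp g)).reverse ++ m.auxPrio)
        upper := g.map plain }.mem) ((Regs.idle fl).set (some (Sym.endFact, hp f)),
      { m with
        prio := plain Sym.endGroup :: rest
        auxPrio := (factCells f (hp f)).reverse ++ ((factCells g (hp g)).reverse ++ m.auxPrio)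
        upper := g.map plain }.mem) 1 :=
    .push_of (by simp [factCells, Regs.val, Regs.set])
  -- The two branches leave different symbols in the register. Its value `r` is irrelevant because
  -- the next pop overwrites it.
  have h5 : ∃ r, Runs (.ite (fun v => v.val.2.2)
      (.seq (.load fun v => v.set none)
        (sweep .edges .upper (fun eq b => (b.1, b.2 || eq)) keepFlags id))
      (.load id)) ((Regs.idle fl).set (some (Sym.endFact, hp f)),
      { m with
        prio := plain Sym.endGroup :: rest
        auxPrio := (factCells f (hp f)).reverse ++ ((factCells g (hp g)).reverse ++ m.auxPrio)
        upper := g.map plain }.mem)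
      ((Regs.idle fl).set r,
      { m with
        prio := plain Sym.endGroup :: rest
        auxPrio := (factCells f (hp f)).reverse ++ ((factCells g (hp g)).reverse ++ m.auxPrio)
        upper := g.map plain
        edges := tape (fun w => ((h w).1, (h w).2 || ((hp f).2 && decide (w = g)))) es }.mem)
      ((2 * g.length + 14) * ((tape h es).length + 1) + 2) := by
    cases hb : (hp f).2 with
    | false =>
      refine ⟨some (Sym.endFact, hp f), (Runs.ite_false (by simp [Regs.val, Regs.set, hb])
        (.load _ _ _)).congr (by simp [← hE]) (by nlinarith)⟩
    | true =>
      refine ⟨none, (Runs.ite_true (by simp [Regs.val, Regs.set, hb])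
        (.seq (.load_of rfl) (runs_sweep ⟨by decide, by decide, by decide, by decide, by decide⟩
          hes fl (c := g) hE rfl rfl rfl))).congr ?_ (by omega)⟩
      simp only [foldl_keepFlags]
      simp [Regs.idle, Regs.set]
  obtain ⟨r, h5⟩ := h5
  refine (Iter.single (v' := (Regs.idle fl).set (some x)) (s' := { m with prio := l }.mem)
    rfl (by simp [hx]) (by simp [hx]) (h1.seq ((h2.congr (by simp; rfl) le_rfl).seq
    ((h3.congr (by simp; rfl) le_rfl).seq (h4.seq (h5.seq (.seq (.pop_of rfl rfl)
    (.seq (.push_of rfl) (runs_clear _ _ _))))))))).congr ?_ ?_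
  · simp [Regs.idle, Regs.set, Regs.val, groupCells, hu]
  · simp
    nlinarith

end PrefRepair

/-! ### Revising one fact, and passes over all facts. -/

namespace PrefRepair

open StackProg

theorem runs_markUpper {m : Layout} {M : ℕ} {h hp : List Sym → Bool × Bool}
    {es : List (List (List Sym))} {ps : List (List Sym × List Sym)} {fl : Bool × Bool × Bool}
    (hes : ∀ l ∈ es, ∀ w ∈ l, IsWord w) (hps : ∀ p ∈ ps, IsWord p.1 ∧ IsWord p.2)
    (hE : m.edges = tape h es) (hP : m.prio = tape hp (pairGroups ps))
    (hu : m.upper = []) (hM : (tape h es).length < M)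
    (hpM : ∀ p ∈ ps, p.1.length < M ∧ p.2.length < M) :
    Runs markUpper (Regs.idle fl, m.mem)
      (Regs.idle fl, { m with
        prio := []
        auxPrio := (tape hp (pairGroups ps)).reverse ++ m.auxPrio
        edges := tape (fun w =>
          ((h w).1, (h w).2 || ps.any fun p => (hp p.2).2 && decide (w = p.1))) es }.mem)
      (60 * M ^ 2 * ps.length + 1) := by
  have key : Iter .prio Regs.set (fun v => v.reg.isSome) markUpperPair
      (Regs.idle fl, m.mem)
      (Regs.idle fl, { m with
        prio := []
        auxPrio := (tape hp (pairGroups ps)).reverse ++ m.auxPrio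
        edges := tape (fun w =>
          ((h w).1, (h w).2 || ps.any fun p => (hp p.2).2 && decide (w = p.1))) es }.mem)
      (60 * M ^ 2 * ps.length) := by
    induction ps generalizing m h with
    | nil =>
      refine (Iter.refl _).congr ?_ (by simp)
      obtain ⟨⟩ := m
      simp_all [tape, pairGroups]
    | cons p ps ih =>
      have h1 := iter_markUpper (m := m) (fl := fl) (M := M) (h := h) (hp := hp) (g := p.1)
        (f := p.2) (rest := tape hp (pairGroups ps)) hes (hps p (by simp)).1 (hps p (by simp)).2 hE
        (by rw [hP]; simp [pairGroups, tape]) hu hM (hpM p (by simp)).1 (hpM p (by simp)).2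
      refine (h1.trans (ih (h := fun w => ((h w).1, (h w).2 || ((hp p.2).2 && decide (w = p.1))))
        (fun q hq => hps q (by simp [hq])) rfl rfl hu
        ?_ fun q hq => hpM q (by simp [hq]))).congr ?_ ?_
      · simpa [tape, groupCells, factCells, List.length_flatMap] using hM
      · simp [pairGroups, tape, Bool.or_assoc]
      · simp
        linarith
  exact key.runs rfl rfl rfl (by simp) le_rfl

/-- Whether the facts that are kept according to `G` exclude `f`: some hyperedge contains `f`, and
all its other facts are kept and are preferred to `f`. -/
def blocked {α : Type} [DecidableEq α] (es : List (List α)) (ps : List (α × α)) (G : α → Bool)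
    (f : α) : Bool :=
  es.any fun l => l.any (fun w => decide (w = f)) &&
    l.all fun w => decide (w = f) || (G w && ps.any fun p => decide (p.2 = f) && decide (w = p.1))

/-- Decide anew whether `f` is kept. -/
def revise {α : Type} [DecidableEq α] (es : List (List α)) (ps : List (α × α)) (G : α → Bool)
    (f : α) : α → Bool :=
  fun w => if w = f then !blocked es ps G f else G w

/-- Search a hyperedge in which all facts except for the current one are kept and preferred to it.
The flags say whether the current fact has been found in the hyperedge, whether all other facts
satisfy the conditions, and whether the search was successful. -/
def testFact (eq : Bool) (b : Bool × Bool) (fl : Bool × Bool × Bool) : Bool × Bool × Bool :=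
  (fl.1 || eq, fl.2.1 && (eq || (b.1 && b.2)), fl.2.2)

/-- The end of a hyperedge is reached in the search. -/
def testGroup (fl : Bool × Bool × Bool) : Bool × Bool × Bool :=
  (false, true, fl.2.2 || (fl.1 && fl.2.1))

theorem foldl_testFact {α : Type} (g : List α) (P : α → Bool) (h : α → Bool × Bool)
    (a b c : Bool) :
    g.foldl (fun fl w => testFact (P w) (h w) fl) (a, b, c) =
      (a || g.any P, b && g.all (fun w => P w || ((h w).1 && (h w).2)), c) := by
  induction g generalizing a b with
  | nil => simp
  | cons w g ih => exact (ih _ _).trans (by simp [Bool.or_assoc, Bool.and_assoc])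

theorem foldl_testGroup {α : Type} (es : List (List α)) (P : α → Bool) (h : α → Bool × Bool)
    (c : Bool) :
    es.foldl (fun fl g => testGroup (g.foldl (fun fl w => testFact (P w) (h w) fl) fl))
      (false, true, c) = (false, true, c || es.any fun g => g.any P &&
        g.all fun w => P w || ((h w).1 && (h w).2)) := by
  induction es generalizing c with
  | nil => simp
  | cons g es ih =>
    rw [List.foldl_cons, foldl_testFact]
    exact (ih _).trans (by simp [Bool.or_assoc])

/-- Set the mark that says whether the current fact is kept, and erase the other mark. -/
def setKept (a : Bool) (eq : Bool) (b : Bool × Bool) : Bool × Bool :=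
  (if eq then a else b.1, false)

/-- Decide anew whether the current fact is kept. -/
noncomputable def reviseFact : Program :=
  .seq (sweep .prio .fact (fun eq _ => (false, eq)) keepFlags id)
  (.seq markUpper
  (.seq (pour .auxPrio .prio)
  (.seq (.load fun _ => Regs.idle (false, true, false))
  (.seq (sweep .edges .fact (fun _ b => b) testFact testGroup)
  (.ite (fun v => v.flags.2.2)
    (sweep .edges .fact (setKept false) keepFlags id)
    (sweep .edges .fact (setKept true) keepFlags id))))))

theorem length_tape_eq (h h' : List Sym → Bool × Bool) (es : List (List (List Sym))) :
    (tape h es).length = (tape h' es).length := by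
  simp [tape, groupCells, factCells, List.length_flatMap]

/-- The final marks `hp'` of the priority pairs are left open, since the first sweep of the next
revision overwrites them. The cubic bound comes from `markUpper`, which may sweep the hyperedges
once per pair. -/
theorem runs_reviseFact {m : Layout} {M : ℕ} {G : List Sym → Bool} {hp : List Sym → Bool × Bool}
    {es : List (List (List Sym))} {ps : List (List Sym × List Sym)} {f : List Sym}
    {fl : Bool × Bool × Bool}
    (hes : ∀ l ∈ es, ∀ w ∈ l, IsWord w) (hps : ∀ p ∈ ps, IsWord p.1 ∧ IsWord p.2)
    (hE : m.edges = tape (fun w => (G w, false)) es) (hP : m.prio = tape hp (pairGroups ps))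
    (hu : m.upper = []) (hy : m.auxPrio = []) (hf : m.fact = f.map plain)
    (hM : m.edges.length < M) (hPM : m.prio.length < M) (hfM : f.length < M) :
    ∃ fl' hp', Runs reviseFact (Regs.idle fl, m.mem)
      (Regs.idle fl', { m with
        prio := tape hp' (pairGroups ps)
        edges := tape (fun w => (revise es ps G f w, false)) es }.mem)
      (150 * M ^ 3) := by
  have hpw : ∀ l ∈ pairGroups ps, ∀ w ∈ l, IsWord w := by
    simp only [pairGroups, List.mem_map]
    rintro _ ⟨p, hp, rfl⟩ w hw
    rcases List.mem_pair.1 hw with rfl | rfl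
    · exact (hps p hp).1
    · exact (hps p hp).2
  have hcount : ps.length ≤ m.prio.length := by
    rw [hP]
    clear hps hP hpw
    induction ps with
    | nil => simp
    | cons p ps ih =>
      simp [pairGroups, tape, groupCells, factCells] at ih ⊢
      omega
  have hpM : ∀ p ∈ ps, p.1.length < M ∧ p.2.length < M := by
    intro p hp'
    have : p.1.length + p.2.length ≤ m.prio.length := by
      rw [hP]
      clear hps hP hpw hcount
      induction ps with
      | nil => simp at hp'
      | cons q ps ih =>
        rcases List.mem_cons.1 hp' with rfl | h
        · simp [pairGroups, tape, groupCells, factCells]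
          omega
        · have := ih h
          simp [pairGroups, tape, groupCells, factCells] at this ⊢
          omega
    omega
  have h1 := runs_sweep (t := .prio) (k := .fact) (upd := fun eq _ => (false, eq))
    (atFact := keepFlags) (atGroup := id)
    ⟨by decide, by decide, by decide, by decide, by decide⟩
    hpw fl (s := m.mem) (c := f) hP rfl hf rfl
  rw [foldl_keepFlags, Layout.update_prio] at h1
  have h2 := runs_markUpper (M := M) (fl := fl) (h := fun w => (G w, false))
    (hp := fun w => (false, decide (w = f)))
    (m := { m with prio := tape (fun w => (false, decide (w = f))) (pairGroups ps) })
    hes hps hE rfl hu (hE ▸ hM) hpM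
  have h3 := runs_sweep (t := .edges) (k := .fact) (upd := fun _ b => b)
    (atFact := testFact) (atGroup := testGroup)
    (h := fun w => (G w, ps.any fun p => decide (p.2 = f) && decide (w = p.1)))
    ⟨by decide, by decide, by decide, by decide, by decide⟩
    hes (false, true, false) (s := { m with
      prio := tape (fun w => (false, decide (w = f))) (pairGroups ps)
      edges := tape (fun w => (G w, ps.any fun p => decide (p.2 = f) && decide (w = p.1))) es }.mem)
    (c := f) rfl rfl hf rfl
  rw [foldl_testGroup, Bool.false_or] at h3
  have h4 : ∀ a, Runs (sweep .edges .fact (setKept a) keepFlags id)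
      (Regs.idle (false, true, blocked es ps G f), { m with
        prio := tape (fun w => (false, decide (w = f))) (pairGroups ps)
        edges := tape (fun w =>
          (G w, ps.any fun p => decide (p.2 = f) && decide (w = p.1))) es }.mem)
      (Regs.idle (false, true, blocked es ps G f), { m with
        prio := tape (fun w => (false, decide (w = f))) (pairGroups ps)
        edges := tape (fun w => (if w = f then a else G w, false)) es }.mem)
      (14 * M ^ 2) := by
    intro a
    refine (runs_sweep (t := .edges) (k := .fact) (upd := setKept a)
      (atFact := keepFlags) (atGroup := id)
      (h := fun w => (G w, ps.any fun p => decide (p.2 = f) && decide (w = p.1)))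
      ⟨by decide, by decide, by decide, by decide, by decide⟩
      hes _ (c := f) rfl rfl hf rfl).congr ?_ ?_
    · rw [foldl_keepFlags]
      simp [setKept]
    · rw [hE, length_tape_eq _ (fun w => (G w, ps.any fun p => decide (p.2 = f) && decide (w = p.1)))] at hM
      nlinarith
  have h5 : Runs (.ite (fun v => v.flags.2.2)
    (sweep .edges .fact (setKept false) keepFlags id)
    (sweep .edges .fact (setKept true) keepFlags id))
      (Regs.idle (false, true, blocked es ps G f), { m with
        prio := tape (fun w => (false, decide (w = f))) (pairGroups ps)
        edges := tape (fun w =>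
          (G w, ps.any fun p => decide (p.2 = f) && decide (w = p.1))) es }.mem)
      (Regs.idle (false, true, blocked es ps G f), { m with
        prio := tape (fun w => (false, decide (w = f))) (pairGroups ps)
        edges := tape (fun w => (revise es ps G f w, false)) es }.mem) (14 * M ^ 2 + 1) := by
    cases hb : blocked es ps G f with
    | true =>
      refine .ite_true (by simp [Regs.idle]) ((hb ▸ h4 false).congr ?_ le_rfl)
      simp [revise, hb]
    | false =>
      refine .ite_false (by simp [Regs.idle]) ((hb ▸ h4 true).congr ?_ le_rfl)
      simp [revise, hb]
  have h6 : Runs (pour .auxPrio .prio) (Regs.idle fl, { m with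
        prio := []
        auxPrio := (tape (fun w => (false, decide (w = f))) (pairGroups ps)).reverse ++ m.auxPrio
        edges := tape (fun w =>
          (G w, false || ps.any fun p => decide (p.2 = f) && decide (w = p.1))) es }.mem)
      (Regs.idle fl, { m with
        prio := tape (fun w => (false, decide (w = f))) (pairGroups ps)
        edges := tape (fun w =>
          (G w, ps.any fun p => decide (p.2 = f) && decide (w = p.1))) es }.mem) (2 * M + 1) := by
    refine (runs_pour (by decide) _ _).congr ?_ ?_
    · simp [hy, Regs.idle, Regs.set]
    · rw [hP, length_tape_eq _ (fun w => (false, decide (w = f)))] at hPM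
      simp [hy]
      omega
  have hE' : ∀ h, (tape h es).length < M := fun h => by
    rw [length_tape_eq _ (fun w => (G w, false)), ← hE]
    exact hM
  have hP' : (tape hp (pairGroups ps)).length < M := by rwa [← hP]
  have h7 := h1.weaken (n := 14 * M ^ 2) (by nlinarith)
  have h8 := h3.weaken (n := 14 * M ^ 2) (by
    have := hE' fun w => (G w, ps.any fun p => decide (p.2 = f) && decide (w = p.1))
    nlinarith)
  have h9 := h2.weaken (n := 60 * M ^ 3 + 1) (by
    rw [pow_succ M 2, ← mul_assoc]
    exact Nat.add_le_add_right (Nat.mul_le_mul_left _ (by omega)) _)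
  -- The flags start as: current fact not yet seen in the hyperedge, no violation so far, no success
  -- so far.
  refine ⟨_, _, (h7.seq (h9.seq (h6.seq (.seq (.load_of rfl)
    ((h8.congr ?_ le_rfl).seq h5))))).weaken ?_⟩
  · simp [blocked]
  · have h1 : 1 ≤ M := by omega
    have h2 : M ≤ M ^ 2 := Nat.le_self_pow (by omega) M
    have h3 : M ^ 2 ≤ M ^ 3 := Nat.pow_le_pow_right h1 (by omega)
    omega

/-- Decide anew, one after the other, whether the facts are kept. -/
noncomputable def revisePass : Program :=
  .loop .facts Regs.set (fun v => v.reg.isSome)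
    (.seq (.push .facts Regs.val)
    (.seq (loadFact .facts .auxFacts .fact)
    (.seq reviseFact (clear .fact))))

theorem runs_revisePass {m : Layout} {M : ℕ} {G : List Sym → Bool} {hp : List Sym → Bool × Bool}
    {es : List (List (List Sym))} {ps : List (List Sym × List Sym)} {fs : List (List Sym)}
    {fl : Bool × Bool × Bool} {b : Bool × Bool}
    (hes : ∀ l ∈ es, ∀ w ∈ l, IsWord w) (hps : ∀ p ∈ ps, IsWord p.1 ∧ IsWord p.2)
    (hfs : ∀ w ∈ fs, IsWord w)
    (hE : m.edges = tape (fun w => (G w, false)) es) (hP : m.prio = tape hp (pairGroups ps))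
    (hF : m.facts = fs.flatMap fun w => factCells w b)
    (hu : m.upper = []) (hy : m.auxPrio = []) (hf : m.fact = [])
    (hM : m.edges.length < M) (hPM : m.prio.length < M) (hfM : ∀ w ∈ fs, w.length < M) :
    ∃ fl' hp', Runs revisePass (Regs.idle fl, m.mem)
      (Regs.idle fl', { m with
        facts := []
        auxFacts := m.facts.reverse ++ m.auxFacts
        prio := tape hp' (pairGroups ps)
        edges := tape (fun w => (fs.foldl (revise es ps) G w, false)) es }.mem)
      (200 * M ^ 3 * fs.length + 1) := by
  have key : ∃ fl' hp', Iter .facts Regs.set (fun v => v.reg.isSome)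
      (.seq (.push .facts Regs.val)
      (.seq (loadFact .facts .auxFacts .fact)
      (.seq reviseFact (clear .fact)))) (Regs.idle fl, m.mem)
      (Regs.idle fl', { m with
        facts := []
        auxFacts := m.facts.reverse ++ m.auxFacts
        prio := tape hp' (pairGroups ps)
        edges := tape (fun w => (fs.foldl (revise es ps) G w, false)) es }.mem)
      (200 * M ^ 3 * fs.length) := by
    induction fs generalizing m G hp fl with
    | nil =>
      refine ⟨fl, hp, (Iter.refl _).congr ?_ (by simp)⟩
      obtain ⟨⟩ := m
      simp_all
    | cons f fs ih =>
      obtain ⟨x, l, hx⟩ : ∃ x l, m.facts = x :: l := by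
        cases h : m.facts with
        | nil => simp [h, factCells] at hF
        | cons x l => exact ⟨x, l, rfl⟩
      have h1 : Runs (.push .facts Regs.val)
          ((Regs.idle fl).set (some x), { m with facts := l }.mem)
          ((Regs.idle fl).set (some x), m.mem) 1 :=
        .push_of (by simp [Regs.val, Regs.set, ← hx])
      have h2 := runs_loadFact (t := .facts) (y := .auxFacts) (k := .fact) (by decide) (by decide)
        (by decide) (by decide) (by decide) (by decide) (v := (Regs.idle fl).set (some x))
        (s := m.mem) (w := f) (b := b) (r := fs.flatMap fun w => factCells w b)
        (hfs f (by simp)) (by simp [hF]) rfl hf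
      obtain ⟨fl₁, hp₁, h3⟩ := runs_reviseFact (fl := fl) (M := M) (f := f) (m := { m with
        facts := fs.flatMap fun w => factCells w b
        auxFacts := (factCells f b).reverse ++ m.auxFacts
        fact := f.map plain }) hes hps hE hP hu hy rfl hM hPM (hfM f (by simp))
      obtain ⟨fl₂, hp₂, h4⟩ := ih (fl := fl₁) (G := revise es ps G f) (m := { m with
        facts := fs.flatMap fun w => factCells w b
        auxFacts := (factCells f b).reverse ++ m.auxFacts
        fact := []
        edges := tape (fun w => (revise es ps G f w, false)) es
        prio := tape hp₁ (pairGroups ps) })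
        (fun w hw => hfs w (by simp [hw])) rfl rfl rfl hu hy rfl
        (by rw [hE] at hM; rwa [length_tape_eq _ (fun w => (G w, false))])
        (by rw [hP] at hPM; rwa [length_tape_eq _ hp]) (fun w hw => hfM w (by simp [hw]))
      refine ⟨fl₂, hp₂, (((Iter.single (v' := (Regs.idle fl).set (some x))
        (s' := { m with facts := l }.mem) rfl (by simp [hx]) (by simp [hx])
        (h1.seq ((h2.congr (by simp; rfl) le_rfl).seq (h3.seq (runs_clear _ _ _))))).congr
        ?_ le_rfl).trans h4).congr ?_ ?_⟩
      · simp [Regs.idle, Regs.set]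
      · simp [hF, hf]
      · have hM1 : f.length < M := hfM f (by simp)
        have h1 : 1 ≤ M := by omega
        have h2 : M ≤ M ^ 3 := Nat.le_self_pow (by omega) M
        simp only [Layout.mem_fact, List.length_map, List.length_cons, mul_add, mul_one]
        omega
  obtain ⟨fl', hp', key⟩ := key
  exact ⟨fl', hp', key.runs rfl rfl rfl (by simp) le_rfl⟩

end PrefRepair

/-! ### Repeated passes, the final consistency check and the whole program. -/

namespace PrefRepair

open StackProg

/-- Decide anew whether the facts are kept, as often as there are symbols on the counter. -/
noncomputable def reviseAll : Program :=
  .loop .count Regs.set (fun v => v.reg.isSome)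
    (.seq (.load fun v => v.set none) (.seq revisePass (pour .auxFacts .facts)))

/-- There are fewer than `M` facts, so a pass with its cubic cost per fact stays within order `M ^
4`. The number of passes is the height of the counter stack. -/
theorem runs_reviseAll {m : Layout} {M : ℕ} {G : List Sym → Bool} {hp : List Sym → Bool × Bool}
    {es : List (List (List Sym))} {ps : List (List Sym × List Sym)} {fs : List (List Sym)}
    {fl : Bool × Bool × Bool} {b : Bool × Bool}
    (hes : ∀ l ∈ es, ∀ w ∈ l, IsWord w) (hps : ∀ p ∈ ps, IsWord p.1 ∧ IsWord p.2)
    (hfs : ∀ w ∈ fs, IsWord w)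
    (hE : m.edges = tape (fun w => (G w, false)) es) (hP : m.prio = tape hp (pairGroups ps))
    (hF : m.facts = fs.flatMap fun w => factCells w b)
    (hu : m.upper = []) (hy : m.auxPrio = []) (hf : m.fact = []) (hz : m.auxFacts = [])
    (hM : m.edges.length < M) (hPM : m.prio.length < M) (hFM : m.facts.length < M) :
    ∃ fl' hp', Runs reviseAll (Regs.idle fl, m.mem)
      (Regs.idle fl', { m with
        count := []
        prio := tape hp' (pairGroups ps)
        edges := tape (fun w =>
          ((fun G => fs.foldl (revise es ps) G)^[m.count.length] G w, false)) es }.mem)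
      (210 * M ^ 4 * m.count.length + 1) := by
  have hfM : ∀ w ∈ fs, w.length < M := by
    intro w hw
    refine lt_of_le_of_lt ?_ hFM
    rw [hF, List.length_flatMap]
    refine le_trans ?_ (List.single_le_sum (by simp) _
      (List.mem_map.2 ⟨w, hw, rfl⟩))
    simp [factCells]
  have hcount : fs.length ≤ m.facts.length := by
    rw [hF]
    clear hF hfM hfs
    induction fs with
    | nil => simp
    | cons w fs ih =>
      simp [factCells] at ih ⊢
      omega
  have key : ∃ fl' hp', Iter .count Regs.set (fun v => v.reg.isSome)
      (.seq (.load fun v => v.set none) (.seq revisePass (pour .auxFacts .facts)))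
      (Regs.idle fl, m.mem)
      (Regs.idle fl', { m with
        count := []
        prio := tape hp' (pairGroups ps)
        edges := tape (fun w =>
          ((fun G => fs.foldl (revise es ps) G)^[m.count.length] G w, false)) es }.mem)
      (210 * M ^ 4 * m.count.length) := by
    generalize hl : m.count = l
    induction l generalizing m G hp fl with
    | nil =>
      refine ⟨fl, hp, (Iter.refl _).congr ?_ (by simp)⟩
      obtain ⟨⟩ := m
      simp_all
    | cons x l ih =>
      obtain ⟨fl₁, hp₁, h1⟩ := runs_revisePass (fl := fl) (M := M) (m := { m with count := l })
        hes hps hfs hE hP hF hu hy hf hM hPM hfM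
      obtain ⟨fl₂, hp₂, h2⟩ := ih (fl := fl₁) (G := fs.foldl (revise es ps) G) (m := { m with
        count := l
        edges := tape (fun w => (fs.foldl (revise es ps) G w, false)) es
        prio := tape hp₁ (pairGroups ps) }) rfl rfl hF hu hy hf hz
        (by rw [hE] at hM; rwa [length_tape_eq _ (fun w => (G w, false))])
        (by rw [hP] at hPM; rwa [length_tape_eq _ hp]) hFM hcount rfl
      refine ⟨fl₂, hp₂, (((Iter.single (v' := (Regs.idle fl).set (some x))
        (s' := { m with count := l }.mem) rfl (by simp [hl]) (by simp [hl])
        ((Runs.load_of (v' := Regs.idle fl) rfl).seq (h1.seq (runs_pour (by decide) _ _)))).congr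
        ?_ le_rfl).trans h2).congr ?_ ?_⟩
      · simp [Regs.idle, Regs.set, hz]
      · simp
      · have h1 : 1 ≤ M := by omega
        have h2 : M ≤ M ^ 4 := Nat.le_self_pow (by omega) M
        have h3 : 200 * M ^ 3 * fs.length ≤ 200 * M ^ 4 := by
          rw [pow_succ M 3, ← mul_assoc]
          exact Nat.mul_le_mul_left _ (by omega)
        simp only [Layout.mem_auxFacts, List.length_append, List.length_reverse, hz,
          List.length_nil, List.length_cons, mul_add, mul_one]
        omega
  obtain ⟨fl', hp', key⟩ := key
  exact ⟨fl', hp', key.runs rfl rfl rfl (by simp) le_rfl⟩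

/-- Search a hyperedge in which all facts are kept. -/
def checkFact (_ : Bool) (b : Bool × Bool) (fl : Bool × Bool × Bool) : Bool × Bool × Bool :=
  (fl.1, fl.2.1 && b.1, fl.2.2)

/-- The end of a hyperedge is reached in the search. -/
def checkGroup (fl : Bool × Bool × Bool) : Bool × Bool × Bool :=
  (fl.1, true, fl.2.2 || fl.2.1)

theorem foldl_checkFact {α : Type} (g : List α) (P : α → Bool) (h : α → Bool × Bool)
    (a b c : Bool) :
    g.foldl (fun fl w => checkFact (P w) (h w) fl) (a, b, c) =
      (a, b && g.all (fun w => (h w).1), c) := by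
  induction g generalizing b with
  | nil => simp
  | cons w g ih => exact (ih _).trans (by simp [Bool.and_assoc])

theorem foldl_checkGroup {α : Type} (es : List (List α)) (P : α → Bool) (h : α → Bool × Bool)
    (a c : Bool) :
    es.foldl (fun fl g => checkGroup (g.foldl (fun fl w => checkFact (P w) (h w) fl) fl))
      (a, true, c) = (a, true, c || es.any fun g => g.all fun w => (h w).1) := by
  induction es generalizing c with
  | nil => simp
  | cons g es ih =>
    rw [List.foldl_cons, foldl_checkFact]
    exact (ih _).trans (by simp [Bool.or_assoc])

/-- Whether a symbol belongs to the current section of the input. -/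
noncomputable def inSection (x : Cell) : Bool := !decide (x.1 = Sym.endSection)

/-- Distribute the input to the stacks. -/
noncomputable def readInput : Program :=
  -- The input lies reversed, with its last section on top, and pouring restores the order within
  -- each section. The facts section is also copied as the counter, and the arities are discarded.
  .seq (.pop .input Regs.set)
  (.seq (pourWhile inSection .input .prio)
  (.seq (pourWhile inSection .input .edges)
  (.seq (copyWhile inSection .input .facts .count) (clear .input))))

/-- Decide whether there is exactly one globally-optimal repair. The third flag is the negation of
the answer. -/
noncomputable def decideCategoricity : Program :=
  .seq readInput
  (.seq reviseAll
  (.seq (.load fun _ => Regs.idle (false, true, false))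
  (.seq (sweep .edges .fact (fun _ b => b) checkFact checkGroup)
  (.seq (clear .edges) (.seq (clear .prio) (clear .facts))))))

/-- The layout of the stacks at the beginning, and the empty layout for `l = []`. -/
def startLayout (l : List Cell) : Layout := ⟨l, [], [], [], [], [], [], [], []⟩

theorem runs_readInput {as fs es ps : List Cell} (hfs : ∀ x ∈ fs, inSection x = true)
    (hes : ∀ x ∈ es, inSection x = true) (hps : ∀ x ∈ ps, inSection x = true)
    (fl : Bool × Bool × Bool) :
    Runs readInput (Regs.idle fl, (startLayout (as ++ plain Sym.endSection ::
        (fs ++ plain Sym.endSection :: (es ++ plain Sym.endSection ::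
        (ps ++ [plain Sym.endSection])))).reverse).mem)
      (Regs.idle fl, (⟨[], fs, es, ps, [], [], [], [], fs⟩ : Layout).mem)
      (3 * (as.length + fs.length + es.length + ps.length) + 10) := by
  have hx : inSection (plain Sym.endSection) = false := by simp [inSection, plain]
  set x := plain Sym.endSection with hxdef
  have h1 : Runs (.pop .input Regs.set) (Regs.idle fl, (startLayout (as ++ x ::
        (fs ++ x :: (es ++ x :: (ps ++ [x])))).reverse).mem)
      ((Regs.idle fl).set (some x), (startLayout (ps.reverse ++ x :: (es.reverse ++ x ::
        (fs.reverse ++ x :: as.reverse)))).mem) 1 :=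
    .pop_of (by simp [startLayout]) (by simp [startLayout])
  have h2 := runs_pourWhile (c := inSection) (a := .input) (b := .prio) (by decide)
    (v := (Regs.idle fl).set (some x)) (s := (startLayout (ps.reverse ++ x :: (es.reverse ++ x ::
        (fs.reverse ++ x :: as.reverse)))).mem) (l := ps.reverse)
    (r := x :: (es.reverse ++ x :: (fs.reverse ++ x :: as.reverse))) (by simpa using hps)
    (by simp [hx]) rfl
  have h3 := runs_pourWhile (c := inSection) (a := .input) (b := .edges) (by decide)
    (v := (Regs.idle fl).set (some x)) (s := { startLayout (es.reverse ++ x ::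
        (fs.reverse ++ x :: as.reverse)) with prio := ps }.mem) (l := es.reverse)
    (r := x :: (fs.reverse ++ x :: as.reverse)) (by simpa using hes)
    (by simp [hx]) rfl
  have h4 := runs_copyWhile (c := inSection) (a := .input) (b := .facts) (b' := .count) (by decide)
    (by decide) (by decide)
    (v := (Regs.idle fl).set (some x)) (s := { startLayout
      (fs.reverse ++ x :: as.reverse) with prio := ps, edges := es }.mem) (l := fs.reverse)
    (r := x :: as.reverse) (by simpa using hfs) (by simp [hx]) rfl
  refine (h1.seq ((h2.congr ?_ le_rfl).seq ((h3.congr ?_ le_rfl).seq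
    (h4.seq (runs_clear _ _ _))))).congr ?_ ?_
  · simp [startLayout, Regs.set]
  · simp [startLayout, Regs.set]
  · simp [startLayout, Regs.set, Regs.idle]
  · simp [startLayout]
    omega

/-- The facts that are finally kept. -/
def finallyKept {α : Type} [DecidableEq α] (fs : List α) (es : List (List α)) (ps : List (α × α))
    (n : ℕ) : α → Bool :=
  (fun G => fs.foldl (revise es ps) G)^[n] fun _ => false

theorem inSection_of_mem_factCells {w : List Sym} {b : Bool × Bool} (hw : IsWord w) {x : Cell}
    (hx : x ∈ factCells w b) : inSection x = true := by
  simp only [factCells, List.mem_append, List.mem_map, List.mem_singleton] at hx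
  rcases hx with ⟨a, ha, rfl⟩ | rfl
  · have := hw a ha
    cases a <;> simp_all [inFact, inSection, plain]
  · simp [inSection]

theorem inSection_of_mem_tape {h : List Sym → Bool × Bool} {es : List (List (List Sym))}
    (hes : ∀ l ∈ es, ∀ w ∈ l, IsWord w) {x : Cell} (hx : x ∈ tape h es) : inSection x = true := by
  simp only [tape, groupCells, List.mem_flatMap, List.mem_append, List.mem_singleton] at hx
  obtain ⟨l, hl, ⟨w, hw, hx⟩ | rfl⟩ := hx
  · exact inSection_of_mem_factCells (hes l hl w hw) hx
  · simp [inSection, plain]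

theorem runs_decideCategoricity {as : List Cell} {fs : List (List Sym)}
    {es : List (List (List Sym))} {ps : List (List Sym × List Sym)} {input : List Cell}
    (hes : ∀ l ∈ es, ∀ w ∈ l, IsWord w) (hps : ∀ p ∈ ps, IsWord p.1 ∧ IsWord p.2)
    (hfs : ∀ w ∈ fs, IsWord w)
    (hinput : input = as ++ plain Sym.endSection ::
      (fs.flatMap (fun w => factCells w (false, false)) ++ plain Sym.endSection ::
      (tape (fun _ => (false, false)) es ++ plain Sym.endSection ::
      (tape (fun _ => (false, false)) (pairGroups ps) ++ [plain Sym.endSection])))) :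
    ∃ v : Regs, v.flags.2.2 = (es.any fun l => l.all (finallyKept fs es ps
        (fs.flatMap fun w => factCells w (false, false)).length)) ∧
      Runs decideCategoricity (Regs.idle (false, false, false), (startLayout input.reverse).mem)
        (v, fun _ => []) (300 * (input.length + 1) ^ 5) := by
  have hpw : ∀ l ∈ pairGroups ps, ∀ w ∈ l, IsWord w := by
    simp only [pairGroups, List.mem_map]
    rintro _ ⟨p, hp, rfl⟩ w hw
    rcases List.mem_pair.1 hw with rfl | rfl
    · exact (hps p hp).1
    · exact (hps p hp).2
  set F := fs.flatMap fun w => factCells w (false, false) with hF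
  have hlen : input.length = as.length + F.length + (tape (fun _ => (false, false)) es).length +
      (tape (fun _ => (false, false)) (pairGroups ps)).length + 4 := by
    rw [hinput]
    simp
    omega
  set M := input.length + 1 with hMdef
  have h1 := runs_readInput (as := as) (fs := F) (es := tape (fun _ => (false, false)) es)
    (ps := tape (fun _ => (false, false)) (pairGroups ps)) (fl := (false, false, false))
    (fun x hx => by
      obtain ⟨w, hw, hx⟩ := List.mem_flatMap.1 hx
      exact inSection_of_mem_factCells (hfs w hw) hx)
    (fun x hx => inSection_of_mem_tape hes hx) (fun x hx => inSection_of_mem_tape hpw hx)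
  rw [← hinput] at h1
  obtain ⟨fl, hp, h2⟩ := runs_reviseAll (fl := (false, false, false)) (M := M)
    (G := fun _ => false) (hp := fun _ => (false, false))
    (m := ⟨[], F, tape (fun _ => (false, false)) es,
      tape (fun _ => (false, false)) (pairGroups ps), [], [], [], [], F⟩) hes hps hfs rfl rfl hF
    rfl rfl rfl rfl (by simp only; omega) (by simp only; omega) (by simp only; omega)
  -- `checkFact` ignores the outcome of the comparison, so the empty stack `.fact` serves as the
  -- key.
  have h3 := runs_sweep (t := .edges) (k := .fact) (upd := fun _ b => b)
    (atFact := checkFact) (atGroup := checkGroup)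
    (h := fun w => (finallyKept fs es ps F.length w, false))
    ⟨by decide, by decide, by decide, by decide, by decide⟩
    hes (false, true, false) (s := (⟨[], F, tape (fun w =>
      (finallyKept fs es ps F.length w, false)) es, tape hp (pairGroups ps), [], [], [], [],
      []⟩ : Layout).mem) (c := []) rfl rfl rfl rfl
  rw [foldl_checkGroup, Bool.false_or] at h3
  refine ⟨Regs.idle (false, true, es.any fun l => l.all (finallyKept fs es ps F.length)), rfl,
    (h1.seq (h2.seq (.seq (.load_of rfl) (h3.seq ((runs_clear _ _ _).seq
    ((runs_clear _ _ _).seq (runs_clear _ _ _))))))).congr ?_ ?_⟩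
  · refine Prod.ext rfl (funext fun j => ?_)
    cases j <;> simp
  · have e1 := length_tape_eq (fun w => (finallyKept fs es ps F.length w, false))
      (fun _ => (false, false)) es
    have e2 := length_tape_eq hp (fun _ => (false, false)) (pairGroups ps)
    have h1 : 1 ≤ M := by omega
    have h2 : M ≤ M ^ 5 := Nat.le_self_pow (by omega) M
    have h3 : 210 * M ^ 4 * F.length ≤ 210 * M ^ 5 := by
      rw [pow_succ M 4, ← mul_assoc]
      exact Nat.mul_le_mul_left _ (by omega)
    simp [e1, e2]
    omega

end PrefRepair

/-! ### Correctness of the repeated revisions. -/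

namespace PrefRepair

open StackProg

section finallyKept

variable {α : Type} [DecidableEq α] {fs : List α} {es : List (List α)} {ps : List (α × α)}

/-- The values of `G` matter only for facts preferred to `f`, because any other fact already fails
the second conjunct. -/
theorem blocked_congr {G G' : α → Bool} {f : α} (h : ∀ g, (g, f) ∈ ps → G g = G' g) :
    blocked es ps G f = blocked es ps G' f := by
  have : ∀ w, (G w && ps.any fun p => decide (p.2 = f) && decide (w = p.1)) =
      (G' w && ps.any fun p => decide (p.2 = f) && decide (w = p.1)) := by
    intro w
    cases hw : ps.any fun p => decide (p.2 = f) && decide (w = p.1) with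
    | false => simp
    | true =>
      simp only [List.any_eq_true, Bool.and_eq_true, decide_eq_true_eq] at hw
      obtain ⟨⟨a, b⟩, hp, rfl, rfl⟩ := hw
      rw [h _ hp]
  simp only [blocked, this]

theorem blocked_eq_true {G : α → Bool} {f : α} : blocked es ps G f = true ↔
    ∃ l ∈ es, f ∈ l ∧ ∀ w ∈ l, w ≠ f → G w = true ∧ (w, f) ∈ ps := by
  simp only [blocked, List.any_eq_true, Bool.and_eq_true, List.all_eq_true, decide_eq_true_eq,
    Bool.or_eq_true]
  constructor
  · rintro ⟨l, hl, ⟨w, hw, rfl⟩, h⟩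
    refine ⟨l, hl, hw, fun w' hw' hne => ?_⟩
    obtain ⟨h1, ⟨a, b⟩, hp, rfl, rfl⟩ := (h w' hw').resolve_left hne
    exact ⟨h1, hp⟩
  · rintro ⟨l, hl, hf, h⟩
    refine ⟨l, hl, ⟨f, hf, rfl⟩, fun w hw => ?_⟩
    by_cases hne : w = f
    · exact Or.inl hne
    · exact Or.inr ⟨(h w hw hne).1, _, (h w hw hne).2, rfl, rfl⟩

/-- If the priority relation decreases a rank, then sufficiently many revisions of all facts lead to
the solution of the greedy recursion. -/
theorem finallyKept_eq {rank : α → ℕ} (hrank : ∀ g f, (g, f) ∈ ps → rank g < rank f)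
    (hmem : ∀ g f, (g, f) ∈ ps → g ∈ fs) {G : α → Bool}
    (hG : ∀ f ∈ fs, G f = !blocked es ps G f) {n : ℕ} {f : α} (hf : f ∈ fs) (hn : rank f < n) :
    finallyKept fs es ps n f = G f := by
  -- The rule for a fact of rank at most `n` consults only facts of smaller rank, which are already
  -- right.
  have step : ∀ (n : ℕ) (H : α → Bool) (f : α), f ∈ fs → rank f ≤ n →
      (∀ g ∈ fs, rank g < n → H g = G g) → revise es ps H f f = G f := by
    intro n H f hf hfn hH
    rw [revise, if_pos rfl, hG f hf]
    rw [blocked_congr fun g hg => hH g (hmem g f hg) ((hrank g f hg).trans_le hfn)]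
  -- Facts are revised in place during a pass. No harm is done: facts of rank below `n` stay right,
  -- and one of rank `n` becomes right when it is reached and stays so.
  have pass : ∀ (n : ℕ) (l : List α), l ⊆ fs → ∀ H : α → Bool,
      (∀ g ∈ fs, rank g < n → H g = G g) →
      (∀ g ∈ fs, rank g < n → l.foldl (revise es ps) H g = G g) ∧
      (∀ g ∈ fs, rank g ≤ n → (g ∈ l ∨ H g = G g) → l.foldl (revise es ps) H g = G g) := by
    intro n l
    induction l with
    | nil => exact fun _ H hH => ⟨hH, fun g _ _ h => h.resolve_left (by simp)⟩
    | cons f l ih =>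
      intro hl H hH
      have hf : f ∈ fs := hl (by simp)
      have hH' : ∀ g ∈ fs, rank g < n → revise es ps H f g = G g := by
        intro g hg hgn
        by_cases hgf : g = f
        · subst hgf
          exact step n H g hg hgn.le hH
        · simpa [revise, hgf] using hH g hg hgn
      obtain ⟨h1, h2⟩ := ih (fun x hx => hl (by simp [hx])) _ hH'
      refine ⟨h1, fun g hg hgn h => h2 g hg hgn ?_⟩
      by_cases hgf : g = f
      · subst hgf
        exact Or.inr (step n H g hg hgn hH)
      · rcases h with h | h
        · exact Or.inl ((List.mem_cons.1 h).resolve_left hgf)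
        · exact Or.inr (by simpa [revise, hgf] using h)
  have main : ∀ n, ∀ g ∈ fs, rank g < n → finallyKept fs es ps n g = G g := by
    intro n
    induction n with
    | zero => simp
    | succ n ih =>
      intro g hg hgn
      rw [finallyKept, Function.iterate_succ_apply']
      exact (pass n fs (fun _ h => h) _ ih).2 g hg (by omega) (Or.inl hg)
  exact main n f hf hn

end finallyKept

/-! ### The encoding of facts -/

/-- A fact as a word. -/
def factWord {S : Signature} (f : Fact S (List Bool)) : List Sym :=
  (Computability.encodeNat f.1 :: List.ofFn f.2).flatMap encodeString

theorem isWord_factWord {S : Signature} (f : Fact S (List Bool)) : IsWord (factWord f) := by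
  intro x hx
  simp only [factWord, List.mem_flatMap, encodeString, List.mem_append, List.mem_map,
    List.mem_singleton] at hx
  obtain ⟨_, _, ⟨_, _, rfl⟩ | rfl⟩ := hx <;> rfl

theorem factWord_injective {S : Signature} :
    Function.Injective (factWord : Fact S (List Bool) → List Sym) := by
  intro f g h
  have : [f].flatMap encodeFact = [g].flatMap encodeFact := by
    simp only [List.flatMap_singleton, encodeFact]
    exact congrArg (· ++ [Sym.endFact]) h
  simpa using flatMap_encodeFact_injective this

theorem map_plain_encodeFact {S : Signature} (f : Fact S (List Bool)) :
    (encodeFact f).map plain = factCells (factWord f) (false, false) := by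
  simp [encodeFact, factWord, factCells, plain]

theorem map_plain_facts {S : Signature} (l : List (Fact S (List Bool))) :
    (l.flatMap encodeFact).map plain =
      (l.map factWord).flatMap fun w => factCells w (false, false) := by
  simp [List.map_flatMap, List.flatMap_map, map_plain_encodeFact]

theorem map_plain_groups {S : Signature} (es : List (List (Fact S (List Bool)))) :
    (es.flatMap encodeGroup).map plain =
      tape (fun _ => (false, false)) (es.map (List.map factWord)) := by
  simp [List.map_flatMap, List.flatMap_map, tape, groupCells, encodeGroup, map_plain_encodeFact]

theorem exists_map_plain_encode (d : Description) : ∃ as, d.encode.map plain =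
    as ++ plain Sym.endSection ::
      ((d.facts.map factWord).flatMap (fun w => factCells w (false, false)) ++
        plain Sym.endSection ::
      (tape (fun _ => (false, false)) (d.edges.map (List.map factWord)) ++ plain Sym.endSection ::
      (tape (fun _ => (false, false)) (pairGroups (d.prio.map (Prod.map factWord factWord))) ++
        [plain Sym.endSection]))) := by
  refine ⟨(((List.ofFn d.sig.arity).map Computability.encodeNat).flatMap encodeString).map plain,
    ?_⟩
  rw [← map_plain_facts, ← map_plain_groups]
  have : tape (fun _ => (false, false)) (pairGroups (d.prio.map (Prod.map factWord factWord))) =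
      ((d.prio.map fun p => [p.1, p.2]).flatMap encodeGroup).map plain := by
    rw [map_plain_groups]
    simp [pairGroups, Function.comp_def]
  rw [this]
  simp [Description.encode]

/-- Membership in a decisive set obeys the greedy recursion as well: a kept fact has no excluding
hyperedge, as this would be wholly kept against consistency. The two solutions agree by induction on
the height. -/
theorem PrioritizingInstance.Decisive.mem_iff {S : Signature} {C : Type*}
    {D : PrioritizingInstance S C} {G : Finset (Fact S C)} (hG : D.Decisive G)
    {K : Fact S C → Prop}
    (hK : ∀ f, K f ↔ ¬ ∃ e ∈ D.edges, f ∈ e ∧ ∀ g ∈ e, g ≠ f → K g ∧ D.Prefers g f)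
    {f : Fact S C} (hf : f ∈ D.facts) : f ∈ G ↔ K f := by
  induction hn : D.height f using Nat.strong_induction_on generalizing f with
  | _ n ih =>
    have ih' : ∀ g, D.Prefers g f → (g ∈ G ↔ K g) := fun g hg =>
      ih _ (hn ▸ PrioritizingInstance.height_lt hg) (D.prefers_mem g f hg).1 rfl
    rw [hK]
    constructor
    · rintro hfG ⟨e, he, hfe, h⟩
      refine hG.1.2 e he fun g hg => ?_
      by_cases hgf : g = f
      · exact hgf ▸ hfG
      · exact (ih' g (h g hg hgf).2).2 (h g hg hgf).1
    · intro hno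
      by_contra hfG
      obtain ⟨e, he, hfe, h⟩ := hG.2 f hf hfG
      exact hno ⟨e, he, hfe, fun g hg hgf =>
        ⟨(ih' g (h g hg hgf).2).1 (h g hg hgf).1, (h g hg hgf).2⟩⟩

/-- The facts that the machine finally keeps contain no hyperedge if and only if some set of facts
is decisive. -/
theorem Description.Describes.exists_decisive_iff {d : Description}
    {D : PrioritizingInstance d.sig (List Bool)} (h : d.Describes D) {n : ℕ}
    (hn : d.facts.length ≤ n) :
    (∃ G, D.Decisive G) ↔ ((d.edges.map (List.map factWord)).any fun l =>
      l.all (finallyKept (d.facts.map factWord) (d.edges.map (List.map factWord))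
        (d.prio.map (Prod.map factWord factWord)) n)) = false := by
  classical
  obtain ⟨hF, hE, hP⟩ := h
  have hinj := factWord_injective (S := d.sig)
  have hpair : ∀ f g, (factWord f, factWord g) ∈ d.prio.map (Prod.map factWord factWord) ↔
      D.Prefers f g := by
    intro f g
    rw [← hP, List.mem_map]
    constructor
    · rintro ⟨⟨a, b⟩, hp, he⟩
      obtain ⟨h1, h2⟩ := Prod.mk.inj he
      rwa [← hinj h1, ← hinj h2]
    · exact fun h => ⟨_, h, rfl⟩
  have hedge : ∀ l ∈ d.edges, l.toFinset ∈ D.edges := fun l hl => (hE _).2 ⟨l, hl, by simp⟩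
  obtain ⟨K, hK⟩ := D.exists_greedy
  -- The list may repeat facts, so its length only bounds their number. As heights are below that
  -- number, `n` passes reach every fact.
  have hcard : D.facts.card ≤ n := by
    refine le_trans ?_ ((List.toFinset_card_le d.facts).trans hn)
    exact Finset.card_le_card fun f hf => by simpa using (hF f).2 hf
  -- The greedy solution and the height are transported to words along the injective `factWord`. The
  -- default values on other words are never used.
  let G : List Sym → Bool := Function.extend factWord (fun f => decide (K f)) fun _ => false
  let rank : List Sym → ℕ := Function.extend factWord D.height 0
  have hGK : ∀ f, G (factWord f) = decide (K f) := hinj.extend_apply _ _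
  have hrank : ∀ f, rank (factWord f) = D.height f := hinj.extend_apply _ _
  have hblocked : ∀ f, blocked (d.edges.map (List.map factWord))
      (d.prio.map (Prod.map factWord factWord)) G (factWord f) = true ↔
      ∃ e ∈ D.edges, f ∈ e ∧ ∀ g ∈ e, g ≠ f → K g ∧ D.Prefers g f := by
    intro f
    rw [blocked_eq_true]
    constructor
    · rintro ⟨_, hmem, hfl, h⟩
      obtain ⟨l, hl, rfl⟩ := List.mem_map.1 hmem
      refine ⟨l.toFinset, hedge l hl, by simpa [hinj.eq_iff] using hfl, fun g hg hgf => ?_⟩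
      have := h (factWord g) (List.mem_map.2 ⟨g, by simpa using hg, rfl⟩) (hinj.ne hgf)
      rwa [hGK, decide_eq_true_eq, hpair] at this
    · rintro ⟨e, he, hfe, h⟩
      obtain ⟨l, hl, hle⟩ := (hE e).1 he
      refine ⟨l.map factWord, List.mem_map.2 ⟨l, hl, rfl⟩,
        List.mem_map.2 ⟨f, (hle f).2 hfe, rfl⟩, fun w hw hwf => ?_⟩
      obtain ⟨g, hg, rfl⟩ := List.mem_map.1 hw
      rw [hGK, decide_eq_true_eq, hpair]
      exact h g ((hle g).1 hg) fun h => hwf (h ▸ rfl)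
  have hkept : ∀ f ∈ D.facts, finallyKept (d.facts.map factWord) (d.edges.map (List.map factWord))
      (d.prio.map (Prod.map factWord factWord)) n (factWord f) = decide (K f) := by
    intro f hf
    rw [← hGK]
    refine finallyKept_eq (rank := rank) ?_ ?_ ?_ (List.mem_map.2 ⟨f, (hF f).2 hf, rfl⟩) ?_
    · intro w w' hp
      obtain ⟨⟨a, b⟩, hab, he⟩ := List.mem_map.1 hp
      obtain ⟨rfl, rfl⟩ := Prod.mk.inj he
      rw [hrank, hrank]
      exact PrioritizingInstance.height_lt ((hP a b).1 hab)
    · intro w w' hp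
      obtain ⟨⟨a, b⟩, hab, he⟩ := List.mem_map.1 hp
      obtain ⟨rfl, rfl⟩ := Prod.mk.inj he
      exact List.mem_map.2 ⟨a, (hF a).2 (D.prefers_mem a b ((hP a b).1 hab)).1, rfl⟩
    · intro w hw
      obtain ⟨a, ha, rfl⟩ := List.mem_map.1 hw
      rw [hGK, Bool.eq_iff_iff, decide_eq_true_eq, hK, ← hblocked]
      simp
    · rw [hrank]
      exact (PrioritizingInstance.height_lt_card hf).trans_le hcard
  have hany : ((d.edges.map (List.map factWord)).any fun l =>
      l.all (finallyKept (d.facts.map factWord) (d.edges.map (List.map factWord))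
        (d.prio.map (Prod.map factWord factWord)) n)) = false ↔ ∀ e ∈ D.edges, ∃ f ∈ e, ¬ K f := by
    simp only [List.any_eq_false, List.mem_map, forall_exists_index, and_imp,
      forall_apply_eq_imp_iff₂, List.all_eq_true, not_forall]
    constructor
    · intro h e he
      obtain ⟨l, hl, hle⟩ := (hE e).1 he
      obtain ⟨_, ⟨f, hf, rfl⟩, hfK⟩ := h l hl
      have hfe := (hle f).1 hf
      rw [hkept f (D.edges_subset e he hfe), decide_eq_true_eq] at hfK
      exact ⟨f, hfe, hfK⟩
    · intro h l hl
      obtain ⟨f, hf, hfK⟩ := h _ (hedge l hl)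
      refine ⟨_, ⟨f, by simpa using hf, rfl⟩, ?_⟩
      rwa [hkept f (D.edges_subset _ (hedge l hl) hf), decide_eq_true_eq]
  rw [hany]
  constructor
  -- A decisive set coincides with the greedy solution on all facts, so its consistency is exactly
  -- the absence of a wholly kept hyperedge.
  · rintro ⟨H, hH⟩ e he
    obtain ⟨f, hf, hfH⟩ := Finset.not_subset.1 (hH.1.2 e he)
    exact ⟨f, hf, fun h => hfH ((hH.mem_iff hK (D.edges_subset e he hf)).2 h)⟩
  · intro h
    -- Conversely, the kept facts form a decisive set: consistency is the assumption, and the greedy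
    -- rule provides the hyperedges.
    refine ⟨D.facts.filter K, ⟨Finset.filter_subset _ _, fun e he hsub => ?_⟩, fun f hf hfG => ?_⟩
    · obtain ⟨f, hf, hfK⟩ := h e he
      exact hfK (Finset.mem_filter.1 (hsub hf)).2
    · have : ¬ K f := fun h => hfG (Finset.mem_filter.2 ⟨hf, h⟩)
      rw [hK, not_not] at this
      obtain ⟨e, he, hfe, h⟩ := this
      exact ⟨e, he, hfe, fun g hg hgf =>
        ⟨Finset.mem_filter.2 ⟨D.edges_subset e he hg, (h g hg hgf).1⟩, (h g hg hgf).2⟩⟩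

/-- Transitivity enters here, to identify the answer with the existence of a decisive set. The
machine flags a wholly kept hyperedge, hence the negation. -/
theorem runs_decideCategoricity_encode (x : TransitiveInput) :
    ∃ v : Regs, (!v.flags.2.2) = x.gCategorical ∧
      Runs decideCategoricity (Regs.idle (false, false, false),
        Function.update (fun _ => []) .input (x.encode.map plain).reverse) (v, fun _ => [])
        ((300 * (Polynomial.X + 1) ^ 5 : Polynomial ℕ).eval x.encode.length) := by
  obtain ⟨as, has⟩ := exists_map_plain_encode x.desc
  obtain ⟨v, hv, h⟩ := runs_decideCategoricity (as := as)
    (fs := x.desc.facts.map factWord) (es := x.desc.edges.map (List.map factWord))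
    (ps := x.desc.prio.map (Prod.map factWord factWord))
    (by
      intro l hl w hw
      obtain ⟨l, -, rfl⟩ := List.mem_map.1 hl
      obtain ⟨f, -, rfl⟩ := List.mem_map.1 hw
      exact isWord_factWord f)
    (by
      intro p hp
      obtain ⟨p, -, rfl⟩ := List.mem_map.1 hp
      exact ⟨isWord_factWord _, isWord_factWord _⟩)
    (by
      intro w hw
      obtain ⟨f, -, rfl⟩ := List.mem_map.1 hw
      exact isWord_factWord f) has
  refine ⟨v, ?_, ?_⟩
  · classical
    -- The counter has one symbol per cell of the encoded facts, and each fact has at least its end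
    -- symbol.
    have hn : x.desc.facts.length ≤ ((x.desc.facts.map factWord).flatMap
        fun w => factCells w (false, false)).length := by
      generalize x.desc.facts = l
      induction l with
      | nil => simp
      | cons f l ih =>
        simp [factCells] at ih ⊢
        omega
    have := x.describes.exists_decisive_iff hn
    rw [← hv, ← x.transitive.gCategorical_iff] at this
    rw [TransitiveInput.gCategorical, Bool.eq_iff_iff, decide_eq_true_eq, this]
    simp
  · have e : Function.update (fun _ => []) Stack.input (x.encode.map plain).reverse =
        (startLayout (x.desc.encode.map plain).reverse).mem := by
      funext j
      cases j <;> simp [startLayout, TransitiveInput.encode]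
    rw [e]
    simpa [TransitiveInput.encode] using h

end PrefRepair

theorem mainTheorem6 :
    (∀ (S : PrefRepair.Signature) (C : Type*) (D : PrefRepair.PrioritizingInstance S C),
      D.Transitive → (D.GCategorical ↔ D.CCategorical)) ∧
    Nonempty (Turing.TM2ComputableInPolyTime PrefRepair.TransitiveInput.encode
      Computability.encodeBool PrefRepair.TransitiveInput.gCategorical) :=
  ⟨fun _ _ _ h => h.gCategorical_iff_cCategorical,
    StackProg.polyTime_of_runs _ _ PrefRepair.decideCategoricity .input PrefRepair.plain
      (PrefRepair.plain .endSection) (PrefRepair.Regs.idle (false, false, false))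
      (fun v => !v.flags.2.2) (300 * (Polynomial.X + 1) ^ 5)
      PrefRepair.runs_decideCategoricity_encode⟩
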